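/- Let $V$ be a set of $n\ge 2$ vertices arranged on a line graph (the spine) $\mathcal S$, let $\theta,\alpha\in[0,1]$, and let $\Phi_{\mathcal S}(u)$ denote the number of edges of $\mathcal S$ whose endpoints receive different labels under $u\in\{-1,1\}^V$. Put $p_{\mathcal S}(u)=\frac12\,\theta^{\Phi_{\mathcal S}(u)}(1-\theta)^{\,n-1-\Phi_{\mathcal S}(u)}$. The switch-reset distribution $p^{\rm sr}_{\mathcal S}$ on sequences of labelings $u_1,u_2,\dots$ draws $u_1$ from $p_{\mathcal S}$; at the end of each trial $t$, independently with probability $\alpha$, it draws a fresh $u_{t+1}$ from $p_{\mathcal S}$, and otherwise sets $u_{t+1}=u_t$. The conservative quasi-Bayes classifier (Q-BAY) works online: on trial $t=1,2,\dots$ a vertex $i_t$ is queried, a label $\hat y_t\in\{-1,1\}$ is predicted, and then the true label $y_t\in\{-1,1\}$ is revealed. If $s_1<\dots<s_m$ are the trials before $t$ on which a mistake $\hat y_s\ne y_s$ was made, the prediction is $$\hat y_t\in\operatorname*{argmax}_{y\in\{-1,1\}}\ p^{\rm sr}_{\mathcal S}\bigl(u_{m+1}(i_t)=y \,\big|\,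 u_1(i_{s_1})=y_{s_1},\dots,u_m(i_{s_m})=y_{s_m}\bigr),$$ with no requirement on $\hat y_t$ if the conditioning event has probability zero. Proposition. Q-BAY can be computed in $\mathcal O(t\log n)$ time on trial $t$ (prediction and update together), using $\mathcal O(tn)$ space. Precisely: there are one online algorithm, consisting of a finite program run at the query and a finite program run when the label is revealed, for a real random access machine (unit-cost exact arithmetic, division and comparison on real numbers; unit-cost arithmetic, comparison and indirect addressing on words), and a constant $C$, such that for all $n\ge2$, all spines on $n$ vertices (given in the initial memory as the table of the positions of the vertices, together with $n,\alpha,\theta$, the rest of the memory being zero), all $\alpha,\theta\in[0,1]$ and all sequences $(i_t,y_t)_{t\ge1}$, the algorithm makes predictions $\hat y_t$ that are those of Q-BAY, and on every trial $t\ge1$ it takes at most $C\,t\log n$ time steps, uses at most $C\,t\,n$ cells of each of its finitely many arrays, and all words it handles are less than $C\,t\,n$. -/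

import Mathlib

/-! ### The switch-reset model on a spine -/

/-- The cut-size of a labeling: the number of edges between vertices of disagreeing labels. -/
noncomputable def cutSize {V : Type*} (G : SimpleGraph V) (u : V → ℤˣ) : ℕ :=
  Set.ncard {e : Sym2 V | e ∈ G.edgeSet ∧ ∃ a b : V, e = s(a, b) ∧ u a ≠ u b}

/-- The line graph (spine) on the vertex set in which vertex `v` has position `pos v`:
two vertices are adjacent exactly if their positions are consecutive. -/
def spine {n : ℕ} (pos : Fin n ≃ Fin n) : SimpleGraph (Fin n) :=
  (SimpleGraph.pathGraph n).comap pos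

/-- The Ising distribution on labelings of the spine, where `θ` is the probability that
a given edge of the spine is cut. -/
noncomputable def isingProb {n : ℕ} (pos : Fin n ≃ Fin n) (θ : ℝ) (u : Fin n → ℤˣ) : ℝ :=
  1 / 2 * θ ^ cutSize (spine pos) u * (1 - θ) ^ (n - 1 - cutSize (spine pos) u)

open Classical in
/-- Joint probability of the labelings `u 0, …, u m` and of the latent switch-reset variables
`S 0, …, S (m - 1)`. The first labeling is drawn from the Ising distribution; `S j` is true with
probability `α`, in which case `u (j + 1)` is a fresh draw; otherwise `u (j + 1) = u j`. -/
noncomputable def switchResetJoint {n : ℕ} (pos : Fin n ≃ Fin n) (α θ : ℝ) {m : ℕ}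
    (S : Fin m → Bool) (u : Fin (m + 1) → Fin n → ℤˣ) : ℝ :=
  isingProb pos θ (u 0) *
    ∏ j : Fin m,
      if S j = true then α * isingProb pos θ (u j.succ)
      else (1 - α) * (if u j.succ = u j.castSucc then 1 else 0)

/-- The switch-reset distribution over sequences of `m + 1` labelings. -/
noncomputable def switchReset {n : ℕ} (pos : Fin n ≃ Fin n) (α θ : ℝ) {m : ℕ}
    (u : Fin (m + 1) → Fin n → ℤˣ) : ℝ :=
  ∑ S : Fin m → Bool, switchResetJoint pos α θ S u

open Classical in
/-- The probability of an event under the switch-reset distribution. -/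
noncomputable def switchResetProb {n : ℕ} (pos : Fin n ≃ Fin n) (α θ : ℝ) {m : ℕ}
    (E : Set (Fin (m + 1) → Fin n → ℤˣ)) : ℝ :=
  ∑ u : Fin (m + 1) → Fin n → ℤˣ, if u ∈ E then switchReset pos α θ u else 0

/-- The event that the first `D.length` labelings agree with the vertex-label pairs in `D`. -/
def agreesWith {n : ℕ} (D : List (Fin n × ℤˣ)) : Set (Fin (D.length + 1) → Fin n → ℤˣ) :=
  {u | ∀ j : Fin D.length, u j.castSucc (D.get j).1 = (D.get j).2}

/-- The event that the labeling after the `D.length` trials of `D` gives label `b` to `v`. -/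
def nextLabelIs {n : ℕ} (D : List (Fin n × ℤˣ)) (v : Fin n) (b : ℤˣ) :
    Set (Fin (D.length + 1) → Fin n → ℤˣ) :=
  {u | u (Fin.last D.length) v = b}

/-- The conditional probability that `v` has label `b` on the trial that follows the observed
vertex-label pairs `D`. It is `0` for both labels when `D` has probability zero. -/
noncomputable def predictiveProb {n : ℕ} (pos : Fin n ≃ Fin n) (α θ : ℝ)
    (D : List (Fin n × ℤˣ)) (v : Fin n) (b : ℤˣ) : ℝ :=
  switchResetProb pos α θ (nextLabelIs D v b ∩ agreesWith D) /
    switchResetProb pos α θ (agreesWith D)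

/-- The examples of trials `0, …, t - 1` that were mispredicted, in order of time. -/
def mistakeHistory {n : ℕ} (i : ℕ → Fin n) (y yhat : ℕ → ℤˣ) (t : ℕ) : List (Fin n × ℤˣ) :=
  ((List.range t).filter (fun s => yhat s ≠ y s)).map (fun s => (i s, y s))

/-- `yhat` is the sequence of predictions of the conservative quasi-Bayes classifier on the
queries `i` and labels `y`: each prediction is a label of maximum marginal probability, given
the past mispredicted examples only. -/
def IsQBay {n : ℕ} (pos : Fin n ≃ Fin n) (α θ : ℝ) (i : ℕ → Fin n) (y yhat : ℕ → ℤˣ) : Prop :=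
  ∀ (t : ℕ) (b : ℤˣ),
    predictiveProb pos α θ (mistakeHistory i y yhat t) (i t) b ≤
      predictiveProb pos α θ (mistakeHistory i y yhat t) (i t) (yhat t)

/-! ### A real random access machine

The memory consists of arrays of words (natural numbers) and arrays of real numbers. A program
names finitely many arrays; a scalar variable is an array of which one cell is used. Every
operation, memory access and test takes one time step. Real numbers can only be combined
arithmetically, compared, and copied: there is no rounding, and there are no real constants other
than natural numbers. Division by zero gives zero, for words and for reals; subtraction of words
is truncated at zero, and division of words rounds down. -/

namespace RealRAM

structure State where
  word : ℕ → ℕ → ℕ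
  real : ℕ → ℕ → ℝ

def State.setWord (s : State) (a j v : ℕ) : State :=
  { s with word := Function.update s.word a (Function.update (s.word a) j v) }

noncomputable def State.setReal (s : State) (a j : ℕ) (x : ℝ) : State :=
  { s with real := Function.update s.real a (Function.update (s.real a) j x) }

/-- Word expressions; `load a j` is the content of cell `j` of word array `a`. -/
inductive WExpr where
  | lit (k : ℕ)
  | load (a : ℕ) (j : WExpr)
  | add (e f : WExpr)
  | sub (e f : WExpr)
  | mul (e f : WExpr)
  | div (e f : WExpr)

/-- Real expressions; `load a j` is the content of cell `j` of real array `a`. -/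
inductive RExpr where
  | lit (k : ℕ)
  | load (a : ℕ) (j : WExpr)
  | add (e f : RExpr)
  | sub (e f : RExpr)
  | mul (e f : RExpr)
  | div (e f : RExpr)

inductive Test where
  | wordLt (e f : WExpr)
  | wordEq (e f : WExpr)
  | realLt (e f : RExpr)

inductive Prog where
  | skip
  | setWord (a : ℕ) (j e : WExpr)
  | setReal (a : ℕ) (j : WExpr) (e : RExpr)
  | seq (p q : Prog)
  | ite (c : Test) (p q : Prog)
  | loop (c : Test) (p : Prog)

def WExpr.eval (s : State) : WExpr → ℕ
  | lit k => k
  | load a j => s.word a (j.eval s)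
  | add e f => e.eval s + f.eval s
  | sub e f => e.eval s - f.eval s
  | mul e f => e.eval s * f.eval s
  | div e f => e.eval s / f.eval s

noncomputable def RExpr.eval (s : State) : RExpr → ℝ
  | lit k => (k : ℝ)
  | load a j => s.real a (j.eval s)
  | add e f => e.eval s + f.eval s
  | sub e f => e.eval s - f.eval s
  | mul e f => e.eval s * f.eval s
  | div e f => e.eval s / f.eval s

def Test.holds (s : State) : Test → Prop
  | wordLt e f => e.eval s < f.eval s
  | wordEq e f => e.eval s = f.eval s
  | realLt e f => e.eval s < f.eval s

/-- The number of time steps to evaluate an expression. -/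
def WExpr.cost : WExpr → ℕ
  | lit _ => 1
  | load _ j => j.cost + 1
  | add e f => e.cost + f.cost + 1
  | sub e f => e.cost + f.cost + 1
  | mul e f => e.cost + f.cost + 1
  | div e f => e.cost + f.cost + 1

def RExpr.cost : RExpr → ℕ
  | lit _ => 1
  | load _ j => j.cost + 1
  | add e f => e.cost + f.cost + 1
  | sub e f => e.cost + f.cost + 1
  | mul e f => e.cost + f.cost + 1
  | div e f => e.cost + f.cost + 1

def Test.cost : Test → ℕ
  | wordLt e f => e.cost + f.cost + 1
  | wordEq e f => e.cost + f.cost + 1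
  | realLt e f => e.cost + f.cost + 1

/-- All words that occur in the evaluation, in particular all addresses, are below `B`. -/
def WExpr.Fits (B : ℕ) (s : State) : WExpr → Prop
  | lit k => k < B
  | load a j => j.Fits B s ∧ s.word a (j.eval s) < B
  | add e f => e.Fits B s ∧ f.Fits B s ∧ e.eval s + f.eval s < B
  | sub e f => e.Fits B s ∧ f.Fits B s
  | mul e f => e.Fits B s ∧ f.Fits B s ∧ e.eval s * f.eval s < B
  | div e f => e.Fits B s ∧ f.Fits B s

def RExpr.Fits (B : ℕ) (s : State) : RExpr → Prop
  | lit _ => True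
  | load _ j => j.Fits B s
  | add e f => e.Fits B s ∧ f.Fits B s
  | sub e f => e.Fits B s ∧ f.Fits B s
  | mul e f => e.Fits B s ∧ f.Fits B s
  | div e f => e.Fits B s ∧ f.Fits B s

def Test.Fits (B : ℕ) (s : State) : Test → Prop
  | wordLt e f => e.Fits B s ∧ f.Fits B s
  | wordEq e f => e.Fits B s ∧ f.Fits B s
  | realLt e f => e.Fits B s ∧ f.Fits B s

/-- `Exec B p s k s'`: on a machine of capacity `B`, in which every array has `B` cells and every
word is less than `B`, the program `p` started in state `s` halts after `k` time steps in state
`s'`. A program that exceeds the capacity has no such execution. -/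
inductive Exec (B : ℕ) : Prog → State → ℕ → State → Prop where
  | skip (s : State) : Exec B Prog.skip s 1 s
  | setWord (s : State) (a : ℕ) (j e : WExpr) (hj : j.Fits B s) (he : e.Fits B s) :
      Exec B (Prog.setWord a j e) s (j.cost + e.cost + 1) (s.setWord a (j.eval s) (e.eval s))
  | setReal (s : State) (a : ℕ) (j : WExpr) (e : RExpr) (hj : j.Fits B s) (he : e.Fits B s) :
      Exec B (Prog.setReal a j e) s (j.cost + e.cost + 1) (s.setReal a (j.eval s) (e.eval s))
  | seq (p q : Prog) (s s' s'' : State) (k l : ℕ) (hp : Exec B p s k s')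
      (hq : Exec B q s' l s'') : Exec B (Prog.seq p q) s (k + l) s''
  | iteTrue (c : Test) (p q : Prog) (s s' : State) (k : ℕ) (hf : c.Fits B s) (hc : c.holds s)
      (hp : Exec B p s k s') : Exec B (Prog.ite c p q) s (c.cost + k) s'
  | iteFalse (c : Test) (p q : Prog) (s s' : State) (k : ℕ) (hf : c.Fits B s) (hc : ¬ c.holds s)
      (hq : Exec B q s k s') : Exec B (Prog.ite c p q) s (c.cost + k) s'
  | loopDone (c : Test) (p : Prog) (s : State) (hf : c.Fits B s) (hc : ¬ c.holds s) :
      Exec B (Prog.loop c p) s c.cost s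
  | loopStep (c : Test) (p : Prog) (s s' s'' : State) (k l : ℕ) (hf : c.Fits B s)
      (hc : c.holds s) (hp : Exec B p s k s') (hl : Exec B (Prog.loop c p) s' l s'') :
      Exec B (Prog.loop c p) s (c.cost + k + l) s''

/-- An online algorithm: one program that is run when a vertex is queried, and one that is run
when the label of that vertex is revealed. Both work on the same memory, which persists. -/
structure OnlineAlgorithm where
  predict : Prog
  update : Prog

/-- The word by which a label is communicated. -/
def labelWord (b : ℤˣ) : ℕ := if b = 1 then 1 else 0

/-- One trial, on a machine of capacity `B`. The queried vertex `v` is written to cell 1 of word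
array 0 and `predict` is run; cell 3 of word array 0 then holds the prediction `yhat`. Next, the
label `y` is written to cell 2 of word array 0 and `update` is run. Here `k` is the total number
of time steps of the trial, and `s`, `s'` are the memory before and after it. -/
def OnlineAlgorithm.Trial (A : OnlineAlgorithm) (B : ℕ) (s : State) {n : ℕ} (v : Fin n)
    (y yhat : ℤˣ) (k : ℕ) (s' : State) : Prop :=
  ∃ (k₁ k₂ : ℕ) (r : State),
    Exec B A.predict (s.setWord 0 1 (v : ℕ)) k₁ r ∧
    r.word 0 3 = labelWord yhat ∧
    Exec B A.update (r.setWord 0 2 (labelWord y)) k₂ s' ∧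
    k = k₁ + k₂

/-- The memory before the first trial. Cell 0 of word array 0 holds `n`, cells `0, …, n - 1` of
word array 1 hold the positions of the vertices on the spine, cells 0 and 1 of real array 0 hold
`α` and `θ`, and all other cells are zero. -/
noncomputable def initialState {n : ℕ} (pos : Fin n ≃ Fin n) (α θ : ℝ) : State where
  word a j :=
    if a = 0 ∧ j = 0 then n
    else if h : a = 1 ∧ j < n then (pos ⟨j, h.2⟩ : ℕ)
    else 0
  real a j :=
    if a = 0 ∧ j = 0 then α
    else if a = 0 ∧ j = 1 then θ
    else 0

end RealRAM

/-! The posterior over the current labeling is a mixture over the time of the last reset. If `m`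
mistakes were made, component `j ≤ m` is the Ising distribution on the spine conditioned on the
mispredicted pairs from the `j`-th on, and its weight is a coefficient times the Ising
probability of these pairs (`IsMixture`). Observing a pair multiplies the coefficients by `1 - α`
and adds a component whose coefficient is `α` times the joint probability of all pairs so far
(`IsMixture.concat`).

The Ising distribution is a Markov chain along the spine, hence within a component the label of the
queried vertex depends only on the nearest constraints to the left and to the right. A constraint
with label `b` at distance `d` contributes the bias `e = b (1 - 2θ) ^ d`, a missing constraint
contributes `e = 0`, and the conditional probability of the label `y` is
`(1 + y e₀) (1 + y e₁) / (2 (1 + e₀ e₁))` (`isingMarginal_mul_conditional`). This follows from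
writing the marginals as a product of a forward and a backward message, each of which has the form
`s (1 + y e)`.

The constraints of component `j` are those of component `j + 1` and one more. A scan of the
components from `j = m` down to `j = 0` therefore maintains the nearest constraints in constant time
per component, without a search structure; the only other cost is one power of `1 - 2θ` per
component, computed by repeated squaring in `O(log n)` steps (`RealRAM.runs_powerLoop`). The joint
weights found at prediction time become the new weights of the components after a mistake. -/

/-! ### Sums over the paths of a chain -/

theorem sum_intUnits (f : ℤˣ → ℝ) : ∑ a, f a = f 1 + f (-1) := by
  rw [show (Finset.univ : Finset ℤˣ) = {1, -1} from rfl, Finset.sum_pair (by decide)]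

section Chain

variable {U : Type*} [Fintype U]

/-- Forward messages of a chain with initial weights `p₀`, transition weights `T` and local
weights `g`: `forwardMessage p₀ T g m x` is the total weight of all paths of `m` steps that end
in `x`, where the local weight of the last site is left out. -/
noncomputable def forwardMessage (p₀ : U → ℝ) (T : U → U → ℝ) (g : ℕ → U → ℝ) : ℕ → U → ℝ
  | 0, x => p₀ x
  | m + 1, x => ∑ a, forwardMessage p₀ T g m a * g m a * T a x

theorem sum_paths_eq_forwardMessage (p₀ : U → ℝ) (T : U → U → ℝ) (g : ℕ → U → ℝ) (m : ℕ)
    (f : U → ℝ) :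
    ∑ u : Fin (m + 1) → U,
      p₀ (u 0) * (∏ j : Fin m, g j (u j.castSucc) * T (u j.castSucc) (u j.succ)) *
        f (u (Fin.last m)) =
    ∑ x, forwardMessage p₀ T g m x * f x := by
  induction m generalizing f with
  | zero =>
    rw [← (Equiv.funUnique (Fin 1) U).symm.sum_comp]
    simp [forwardMessage]
  | succ m ih =>
    rw [← (Fin.snocEquiv (fun _ : Fin (m + 2) => U)).sum_comp, Fintype.sum_prod_type]
    refine Finset.sum_congr rfl fun x _ => ?_
    rw [forwardMessage, Finset.sum_mul]
    simp only [mul_assoc]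
    have := ih (fun a => g m a * (T a x * f x))
    rw [← this]
    refine Finset.sum_congr rfl fun u _ => ?_
    have h0 : Fin.snoc (α := fun _ : Fin (m + 2) => U) u x 0 = u 0 :=
      Fin.snoc_castSucc (α := fun _ : Fin (m + 2) => U) x u 0
    simp only [Fin.snocEquiv_apply, Fin.prod_univ_castSucc, Fin.snoc_castSucc, Fin.succ_castSucc,
      Fin.succ_last, Fin.snoc_last, Fin.val_castSucc, Fin.val_last, h0]
    ring

theorem forwardMessage_congr (p₀ : U → ℝ) (T : U → U → ℝ) {g g' : ℕ → U → ℝ} {m : ℕ}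
    (h : ∀ j < m, g j = g' j) : forwardMessage p₀ T g m = forwardMessage p₀ T g' m := by
  induction m with
  | zero => rfl
  | succ m ih =>
    funext x
    simp only [forwardMessage, ih fun j hj => h j (by omega), h m (by omega)]

/-- A sum over the paths of a chain with symmetric transition weights factors, at every site,
through a forward message and a message running backward from the last site. -/
theorem sum_forwardMessage_eq_sum_mul_reverse (p₀ : U → ℝ) {T : U → U → ℝ}
    (hT : ∀ a b, T a b = T b a) (g : ℕ → U → ℝ) {N k : ℕ} (hk : k ≤ N) :
    ∑ a, forwardMessage p₀ T g N a * g N a =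
      ∑ a, forwardMessage p₀ T g (N - k) a * g (N - k) a *
        forwardMessage (fun _ => 1) T (fun j => g (N - j)) k a := by
  induction k with
  | zero => simp [forwardMessage]
  | succ k ih =>
    rw [ih (by omega)]
    have e : N - k = (N - (k + 1)) + 1 := by omega
    simp only [forwardMessage, Finset.mul_sum]
    rw [Finset.sum_comm]
    refine Finset.sum_congr rfl fun a _ => ?_
    conv_lhs => rw [e]
    simp only [forwardMessage, Finset.sum_mul]
    rw [← e]
    refine Finset.sum_congr rfl fun b _ => ?_
    rw [hT a b]
    ring

end Chain

/-! ### The Ising chain on the spine -/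

/-- The transition probability along an edge of the spine that is cut with probability `θ`. -/
noncomputable def edgeWeight (θ : ℝ) (a b : ℤˣ) : ℝ := if a = b then 1 - θ else θ

theorem edgeWeight_comm (θ : ℝ) (a b : ℤˣ) : edgeWeight θ a b = edgeWeight θ b a := by
  simp [edgeWeight, eq_comm]

theorem cutSize_spine {N : ℕ} (pos : Fin (N + 1) ≃ Fin (N + 1)) (u : Fin (N + 1) → ℤˣ) :
    cutSize (spine pos) u =
      (Finset.univ.filter fun i : Fin N =>
        ¬ u (pos.symm i.castSucc) = u (pos.symm i.succ)).card := by
  rw [cutSize]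
  have key : {e : Sym2 (Fin (N + 1)) | e ∈ (spine pos).edgeSet ∧ ∃ a b, e = s(a, b) ∧ u a ≠ u b} =
      (fun i : Fin N => s(pos.symm i.castSucc, pos.symm i.succ)) ''
        {i | ¬ u (pos.symm i.castSucc) = u (pos.symm i.succ)} := by
    ext e
    simp only [Set.mem_ofPred_eq, Set.mem_image]
    constructor
    · rintro ⟨he, a, b, rfl, hab⟩
      simp only [spine, SimpleGraph.mem_edgeSet, SimpleGraph.comap_adj,
        SimpleGraph.pathGraph_adj] at he
      rcases he with h | h
      · have hlt : (pos a).val < N := by have := (pos b).isLt; omega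
        have h1 : pos.symm (Fin.castSucc ⟨pos a, hlt⟩) = a := by
          rw [Equiv.symm_apply_eq]; ext; simp
        have h2 : pos.symm (Fin.succ ⟨pos a, hlt⟩) = b := by
          rw [Equiv.symm_apply_eq]; ext; simp [h]
        exact ⟨⟨pos a, hlt⟩, by rw [h1, h2]; exact hab, by rw [h1, h2]⟩
      · have hlt : (pos b).val < N := by have := (pos a).isLt; omega
        have h1 : pos.symm (Fin.castSucc ⟨pos b, hlt⟩) = b := by
          rw [Equiv.symm_apply_eq]; ext; simp
        have h2 : pos.symm (Fin.succ ⟨pos b, hlt⟩) = a := by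
          rw [Equiv.symm_apply_eq]; ext; simp [h]
        exact ⟨⟨pos b, hlt⟩, by rw [h1, h2]; exact hab.symm, by rw [h1, h2]; exact Sym2.eq_swap⟩
    · rintro ⟨i, hi, rfl⟩
      exact ⟨by simp [spine, SimpleGraph.pathGraph_adj], _, _, rfl, hi⟩
  have inj : Function.Injective
      (fun i : Fin N => s(pos.symm i.castSucc, pos.symm i.succ)) := by
    intro i j hij
    simp only [Sym2.eq_iff, EmbeddingLike.apply_eq_iff_eq, Fin.ext_iff, Fin.val_castSucc,
      Fin.val_succ] at hij
    ext
    omega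
  rw [key, Set.ncard_image_of_injective _ inj, Set.ncard_eq_toFinset_card']
  simp

theorem isingProb_eq_prod {N : ℕ} (pos : Fin (N + 1) ≃ Fin (N + 1)) (θ : ℝ)
    (u : Fin (N + 1) → ℤˣ) :
    isingProb pos θ u =
      1 / 2 * ∏ i : Fin N, edgeWeight θ (u (pos.symm i.castSucc)) (u (pos.symm i.succ)) := by
  have h := Finset.card_filter_add_card_filter_not (s := (Finset.univ : Finset (Fin N)))
    (p := fun i : Fin N => u (pos.symm i.castSucc) = u (pos.symm i.succ))
  rw [Finset.card_univ, Fintype.card_fin] at h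
  simp only [isingProb, edgeWeight, Finset.prod_ite, Finset.prod_const, cutSize_spine]
  rw [show N + 1 - 1 - (Finset.univ.filter fun i : Fin N =>
        ¬ u (pos.symm i.castSucc) = u (pos.symm i.succ)).card =
      (Finset.univ.filter fun i : Fin N =>
        u (pos.symm i.castSucc) = u (pos.symm i.succ)).card by omega]
  ring

theorem isingProb_nonneg {n : ℕ} (pos : Fin n ≃ Fin n) {θ : ℝ} (hθ : θ ∈ Set.Icc (0 : ℝ) 1)
    (u : Fin n → ℤˣ) : 0 ≤ isingProb pos θ u := by
  have h0 := hθ.1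
  have h1 : 0 ≤ 1 - θ := by linarith [hθ.2]
  unfold isingProb
  positivity

open Classical in
/-- The probability, under the Ising distribution, of all the vertex-label pairs in `L`. -/
noncomputable def isingMarginal {n : ℕ} (pos : Fin n ≃ Fin n) (θ : ℝ)
    (L : List (Fin n × ℤˣ)) : ℝ :=
  ∑ u : Fin n → ℤˣ, isingProb pos θ u * if ∀ x ∈ L, u x.1 = x.2 then 1 else 0

open Classical in
/-- The local weight at position `k`: the indicator that label `b` there is consistent
with the vertex-label pairs in `L`. -/
noncomputable def consistent {n : ℕ} (pos : Fin n ≃ Fin n) (L : List (Fin n × ℤˣ)) (k : ℕ)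
    (b : ℤˣ) : ℝ :=
  if ∀ x ∈ L, (pos x.1 : ℕ) = k → b = x.2 then 1 else 0

theorem isingMarginal_eq_forwardMessage {N : ℕ} (pos : Fin (N + 1) ≃ Fin (N + 1)) (θ : ℝ)
    (L : List (Fin (N + 1) × ℤˣ)) :
    isingMarginal pos θ L =
      ∑ b, forwardMessage (fun _ => 1 / 2) (edgeWeight θ) (consistent pos L) N b *
        consistent pos L N b := by
  classical
  rw [← sum_paths_eq_forwardMessage, isingMarginal,
    ← (Equiv.arrowCongr pos (Equiv.refl ℤˣ)).symm.sum_comp]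
  refine Finset.sum_congr rfl fun x _ => ?_
  have h : (if ∀ y ∈ L, (Equiv.arrowCongr pos (Equiv.refl ℤˣ)).symm x y.1 = y.2 then (1 : ℝ)
      else 0) = ∏ j : Fin (N + 1), consistent pos L j (x j) := by
    simp only [consistent, Finset.prod_ite_zero, Finset.prod_const_one]
    congr 1
    apply propext
    constructor
    · intro h j _ y hy hj
      have := h y hy
      rw [← this]
      simp [Fin.ext hj]
    · intro h y hy
      simpa using h (pos y.1) (Finset.mem_univ _) y hy rfl
  rw [h, isingProb_eq_prod, Fin.prod_univ_castSucc, Finset.prod_mul_distrib]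
  simp
  ring

theorem isingMarginal_nonneg {n : ℕ} (pos : Fin n ≃ Fin n) {θ : ℝ}
    (hθ : θ ∈ Set.Icc (0 : ℝ) 1) (L : List (Fin n × ℤˣ)) : 0 ≤ isingMarginal pos θ L := by
  classical
  exact Finset.sum_nonneg fun u _ => mul_nonneg (isingProb_nonneg pos hθ u) (by split_ifs <;> simp)

theorem isingMarginal_eq_add {n : ℕ} (pos : Fin n ≃ Fin n) (θ : ℝ)
    (L : List (Fin n × ℤˣ)) (v : Fin n) :
    isingMarginal pos θ L =
      isingMarginal pos θ ((v, 1) :: L) + isingMarginal pos θ ((v, -1) :: L) := by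
  classical
  rw [isingMarginal, isingMarginal, isingMarginal, ← Finset.sum_add_distrib]
  refine Finset.sum_congr rfl fun u _ => ?_
  rw [← mul_add]
  congr 1
  rcases Int.units_eq_one_or (u v) with h | h <;> by_cases h' : ∀ x ∈ L, u x.1 = x.2 <;>
    simp [h]

/-- Past unconstrained sites, the forward message stays uniform. -/
theorem forwardMessage_of_unconstrained (θ c : ℝ) {g : ℕ → ℤˣ → ℝ} {m : ℕ}
    (h : ∀ j < m, ∀ b, g j b = 1) (b : ℤˣ) :
    forwardMessage (fun _ => c) (edgeWeight θ) g m b = c := by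
  induction m generalizing b with
  | zero => rfl
  | succ m ih =>
    simp only [forwardMessage, ih fun j hj => h j (by omega), h m (by omega), sum_intUnits]
    rcases Int.units_eq_one_or b with rfl | rfl <;> simp [edgeWeight] <;> ring

/-- If the label at site `p` must be `a` and the sites after it are unconstrained, then the
bias of the forward message towards `a` decays by a factor `1 - 2θ` per edge. -/
theorem forwardMessage_of_nearest (p₀ : ℤˣ → ℝ) (θ : ℝ) {g : ℕ → ℤˣ → ℝ} {p m : ℕ} {a : ℤˣ}
    (ha : ∀ b, b ≠ a → g p b = 0) (hpm : p < m) (h : ∀ j, p < j → j < m → ∀ b, g j b = 1) :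
    ∃ s : ℝ, ∀ b : ℤˣ, forwardMessage p₀ (edgeWeight θ) g m b =
      s * (1 + ((b : ℤ) : ℝ) * (((a : ℤ) : ℝ) * (1 - 2 * θ) ^ (m - p))) := by
  induction m, Nat.succ_le_of_lt hpm using Nat.le_induction with
  | base =>
    refine ⟨forwardMessage p₀ (edgeWeight θ) g p a * g p a / 2, fun b => ?_⟩
    simp only [Nat.succ_eq_add_one, forwardMessage, sum_intUnits, Nat.add_sub_cancel_left]
    rcases Int.units_eq_one_or a with rfl | rfl <;>
      [have h0 := ha (-1) (by decide); have h0 := ha 1 (by decide)] <;>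
      rcases Int.units_eq_one_or b with rfl | rfl <;> simp [edgeWeight, h0] <;> ring
  | succ m hm ih =>
    obtain ⟨s, hs⟩ := ih (by omega) fun j h1 h2 => h j h1 (by omega)
    refine ⟨s, fun b => ?_⟩
    simp only [forwardMessage, sum_intUnits, hs, h m (by omega) (by omega)]
    rw [show m + 1 - p = (m - p) + 1 by omega, pow_succ]
    rcases Int.units_eq_one_or b with rfl | rfl <;> simp [edgeWeight] <;> ring

/-- `IsNearest pos θ q σ L d e` says what the constraint in `L` that is nearest to position `q`
on one side tells about the label at `q`. The side is given by `σ`: positions at most `q` if `σ`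
is `0`, positions beyond `q` if `σ` is `1`. If there is such a constraint, then `d` is its distance
and `e` its label times `(1 - 2θ) ^ d`, the resulting bias at `q`; otherwise `d` is `n` and
`e` is `0`. -/
def IsNearest {n : ℕ} (pos : Fin n ≃ Fin n) (θ : ℝ) (q σ : ℕ) (L : List (Fin n × ℤˣ))
    (d : ℕ) (e : ℝ) : Prop :=
  (d = n ∧ e = 0 ∧ ∀ x ∈ L, (if q < pos x.1 then 1 else 0) ≠ σ) ∨
  (∃ x ∈ L, (if q < pos x.1 then 1 else 0) = σ ∧ d = (q - pos x.1) + (pos x.1 - q) ∧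
    e = ((x.2 : ℤ) : ℝ) * (1 - 2 * θ) ^ d ∧
    ∀ x' ∈ L, (if q < pos x'.1 then 1 else 0) = σ → d ≤ (q - pos x'.1) + (pos x'.1 - q))

theorem IsNearest.nil {n : ℕ} (pos : Fin n ≃ Fin n) (θ : ℝ) (q σ : ℕ) :
    IsNearest pos θ q σ [] n 0 := Or.inl ⟨rfl, rfl, by simp⟩

theorem IsNearest.dist_le {n : ℕ} {pos : Fin n ≃ Fin n} {θ : ℝ} {q σ : ℕ}
    {L : List (Fin n × ℤˣ)} {d : ℕ} {e : ℝ} (hq : q < n) (h : IsNearest pos θ q σ L d e) :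
    d ≤ n := by
  rcases h with ⟨h, -, -⟩ | ⟨x, -, -, h, -⟩
  · exact h.le
  · have := (pos x.1).isLt
    omega

theorem IsNearest.cons_closer {n : ℕ} {pos : Fin n ≃ Fin n} {θ : ℝ} {q σ : ℕ}
    {L : List (Fin n × ℤˣ)} {d : ℕ} {e : ℝ} (x : Fin n × ℤˣ) (h : IsNearest pos θ q σ L d e)
    (hx : (if q < pos x.1 then 1 else 0) = σ) (hd : (q - pos x.1) + (pos x.1 - q) < d) :
    IsNearest pos θ q σ (x :: L) ((q - pos x.1) + (pos x.1 - q))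
      (((x.2 : ℤ) : ℝ) * (1 - 2 * θ) ^ ((q - pos x.1) + (pos x.1 - q) : ℕ)) := by
  refine Or.inr ⟨x, by simp, hx, rfl, rfl, ?_⟩
  intro x' hx' hσ
  rcases List.mem_cons.1 hx' with rfl | hx'
  · exact le_rfl
  rcases h with ⟨-, -, h⟩ | ⟨-, -, -, -, -, h⟩
  · exact absurd hσ (h x' hx')
  · exact hd.le.trans (h x' hx' hσ)

theorem IsNearest.cons_farther {n : ℕ} {pos : Fin n ≃ Fin n} {θ : ℝ} {q σ : ℕ}
    {L : List (Fin n × ℤˣ)} {d : ℕ} {e : ℝ} (x : Fin n × ℤˣ) (hq : q < n)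
    (h : IsNearest pos θ q σ L d e) (hd : ¬ (q - pos x.1) + (pos x.1 - q) < d) :
    IsNearest pos θ q σ (x :: L) d e := by
  rcases h with ⟨h, -, -⟩ | ⟨x₀, hx₀, h1, h2, h3, h4⟩
  · have := (pos x.1).isLt
    omega
  · refine Or.inr ⟨x₀, by simp [hx₀], h1, h2, h3, ?_⟩
    intro x' hx' hσ
    rcases List.mem_cons.1 hx' with rfl | hx'
    · omega
    · exact h4 x' hx' hσ

theorem IsNearest.cons_otherSide {n : ℕ} {pos : Fin n ≃ Fin n} {θ : ℝ} {q σ : ℕ}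
    {L : List (Fin n × ℤˣ)} {d : ℕ} {e : ℝ} (x : Fin n × ℤˣ)
    (h : IsNearest pos θ q σ L d e) (hx : (if q < pos x.1 then 1 else 0) ≠ σ) :
    IsNearest pos θ q σ (x :: L) d e := by
  rcases h with ⟨h1, h2, h3⟩ | ⟨x₀, hx₀, h1, h2, h3, h4⟩
  · refine Or.inl ⟨h1, h2, ?_⟩
    intro x' hx'
    rcases List.mem_cons.1 hx' with rfl | hx'
    · exact hx
    · exact h3 x' hx'
  · refine Or.inr ⟨x₀, by simp [hx₀], h1, h2, h3, ?_⟩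
    intro x' hx' hσ
    rcases List.mem_cons.1 hx' with rfl | hx'
    · exact absurd hσ hx
    · exact h4 x' hx' hσ

theorem consistent_eq_one {n : ℕ} {pos : Fin n ≃ Fin n} {L : List (Fin n × ℤˣ)} {k : ℕ}
    (h : ∀ x ∈ L, (pos x.1 : ℕ) ≠ k) (b : ℤˣ) : consistent pos L k b = 1 :=
  if_pos fun x hx hk => absurd hk (h x hx)

theorem consistent_eq_zero {n : ℕ} {pos : Fin n ≃ Fin n} {L : List (Fin n × ℤˣ)} {x : Fin n × ℤˣ}
    (hx : x ∈ L) {b : ℤˣ} (hb : b ≠ x.2) : consistent pos L (pos x.1) b = 0 :=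
  if_neg fun h => hb (h x hx rfl)

/-- The message that reaches the queried position from its left, including the constraints at
that position itself, has the bias computed from the nearest constraint. -/
theorem exists_forwardMessage_mul_consistent {n : ℕ} {pos : Fin n ≃ Fin n} {θ : ℝ} {q : ℕ}
    {L : List (Fin n × ℤˣ)} {d : ℕ} {e : ℝ} (h : IsNearest pos θ q 0 L d e) :
    ∃ s : ℝ, ∀ b : ℤˣ,
      forwardMessage (fun _ => 1 / 2) (edgeWeight θ) (consistent pos L) q b *
        consistent pos L q b = s * (1 + ((b : ℤ) : ℝ) * e) := by
  rcases h with ⟨-, rfl, h⟩ | ⟨x, hx, h1, h2, rfl, h4⟩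
  · have h' : ∀ x ∈ L, q < pos x.1 := fun x hx => by simpa using h x hx
    refine ⟨1 / 2, fun b => ?_⟩
    rw [forwardMessage_of_unconstrained θ _ fun j hj b => consistent_eq_one
        (fun x hx hj' => by have := h' x hx; omega) b,
      consistent_eq_one fun x hx => (h' x hx).ne']
    ring
  · have hxq : (pos x.1 : ℕ) ≤ q := by simpa using h1
    rcases hxq.eq_or_lt with he | hlt
    · refine ⟨forwardMessage (fun _ => 1 / 2) (edgeWeight θ) (consistent pos L) q x.2 *
        consistent pos L q x.2 / 2, fun b => ?_⟩
      have hd : d = 0 := by omega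
      rw [hd, pow_zero, mul_one]
      by_cases hb : b = x.2
      · subst hb
        rcases Int.units_eq_one_or x.2 with h | h <;> simp [h] <;> ring
      · have := consistent_eq_zero (pos := pos) hx hb
        rw [he] at this
        have hb' : b = -x.2 := by
          rcases Int.units_eq_one_or x.2 with h | h <;>
            rcases Int.units_eq_one_or b with h' | h' <;> simp_all
        rw [this, hb']
        rcases Int.units_eq_one_or x.2 with h | h <;> simp [h]
    · have near : ∀ x' ∈ L, (pos x'.1 : ℕ) ≤ q → (pos x'.1 : ℕ) ≤ pos x.1 := by
        intro x' hx' hle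
        have := h4 x' hx' (by simpa using hle)
        omega
      obtain ⟨s, hs⟩ := forwardMessage_of_nearest (fun _ => 1 / 2) θ (g := consistent pos L)
        (fun b hb => consistent_eq_zero hx hb) hlt fun j h1 h2 b => consistent_eq_one
          (fun x' hx' hj => by have := near x' hx' (by omega); omega) b
      refine ⟨s, fun b => ?_⟩
      rw [hs, consistent_eq_one fun x' hx' hj => by have := near x' hx' (by omega); omega,
        show d = q - pos x.1 by omega, mul_one]

/-- The message that reaches position `N - k` from its right has the bias computed from the
nearest constraint on that side. -/
theorem exists_reverseMessage {N : ℕ} {pos : Fin (N + 1) ≃ Fin (N + 1)} {θ : ℝ} {k : ℕ}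
    (hk : k ≤ N) {L : List (Fin (N + 1) × ℤˣ)} {d : ℕ} {e : ℝ}
    (h : IsNearest pos θ (N - k) 1 L d e) :
    ∃ s : ℝ, ∀ b : ℤˣ,
      forwardMessage (fun _ => 1) (edgeWeight θ) (fun j => consistent pos L (N - j)) k b =
        s * (1 + ((b : ℤ) : ℝ) * e) := by
  rcases h with ⟨-, rfl, h⟩ | ⟨x, hx, h1, h2, rfl, h4⟩
  · have h' : ∀ x ∈ L, (pos x.1 : ℕ) ≤ N - k := fun x hx => by simpa using h x hx
    refine ⟨1, fun b => ?_⟩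
    rw [forwardMessage_of_unconstrained θ _ fun j hj b => consistent_eq_one
        (fun x hx hj' => by have := h' x hx; omega) b]
    ring
  · have hxq : N - k < (pos x.1 : ℕ) := by simpa using h1
    have hxN := (pos x.1).isLt
    have near : ∀ x' ∈ L, N - k < (pos x'.1 : ℕ) → (pos x.1 : ℕ) ≤ pos x'.1 := by
      intro x' hx' hle
      have := h4 x' hx' (by simpa using hle)
      omega
    obtain ⟨s, hs⟩ := forwardMessage_of_nearest (fun _ => 1) θ
      (g := fun j => consistent pos L (N - j)) (p := N - pos x.1) (a := x.2) (m := k)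
      (fun b hb => by
        rw [show N - (N - (pos x.1 : ℕ)) = pos x.1 by omega]
        exact consistent_eq_zero hx hb) (by omega) fun j h1 h2 b => consistent_eq_one
          (fun x' hx' hj => by have := near x' hx' (by omega); omega) b
    refine ⟨s, fun b => ?_⟩
    rw [hs, show d = k - (N - pos x.1) by omega]

/-- The Markov property of the spine: given the constraints in `L`, the distribution of the label
of `v` depends only on the nearest constraints on its two sides. Where the denominator
vanishes, so does the probability of `L`, hence the value of the division by zero is
of no importance. -/
theorem isingMarginal_mul_conditional {n : ℕ} {pos : Fin n ≃ Fin n} {θ : ℝ}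
    (hθ : θ ∈ Set.Icc (0 : ℝ) 1) {L : List (Fin n × ℤˣ)} {v : Fin n} {d₀ d₁ : ℕ} {e₀ e₁ : ℝ}
    (h₀ : IsNearest pos θ (pos v) 0 L d₀ e₀) (h₁ : IsNearest pos θ (pos v) 1 L d₁ e₁) (b : ℤˣ) :
    isingMarginal pos θ L *
      ((1 + ((b : ℤ) : ℝ) * e₀) * (1 + ((b : ℤ) : ℝ) * e₁) / (2 * (1 + e₀ * e₁))) =
    isingMarginal pos θ ((v, b) :: L) := by
  obtain ⟨N, rfl⟩ : ∃ N, n = N + 1 := ⟨n - 1, by have := v.isLt; omega⟩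
  have hv := (pos v).isLt
  obtain ⟨s, hs⟩ := exists_forwardMessage_mul_consistent h₀
  obtain ⟨r, hr⟩ := exists_reverseMessage (k := N - pos v) (θ := θ) (L := L) (d := d₁) (e := e₁)
    (by omega) (by rwa [show N - (N - (pos v : ℕ)) = pos v by omega])
  have hK : ∀ c : ℤˣ, isingMarginal pos θ ((v, c) :: L) =
      s * r * ((1 + ((c : ℤ) : ℝ) * e₀) * (1 + ((c : ℤ) : ℝ) * e₁)) := by
    intro c
    have hne : ∀ j : ℕ, j ≠ pos v → consistent pos ((v, c) :: L) j = consistent pos L j := by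
      intro j hj
      funext a
      simp [consistent, hj.symm]
    rw [isingMarginal_eq_forwardMessage, sum_forwardMessage_eq_sum_mul_reverse _
      (edgeWeight_comm θ) _ (show N - (pos v : ℕ) ≤ N by omega),
      show N - (N - (pos v : ℕ)) = pos v by omega,
      forwardMessage_congr _ _ (g' := consistent pos L) fun j hj => hne j (by omega),
      forwardMessage_congr (fun _ => 1) _ (g' := fun j => consistent pos L (N - j))
        fun j hj => hne _ (by omega)]
    have hc : ∀ a, consistent pos ((v, c) :: L) (pos v) a =
        consistent pos L (pos v) a * if a = c then 1 else 0 := by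
      intro a
      by_cases h : a = c <;> simp [consistent, h]
    simp only [hc, mul_ite, mul_zero, ite_mul, zero_mul, Finset.sum_ite_eq', Finset.mem_univ,
      if_true, mul_one, hs, hr]
    ring
  have hsum := isingMarginal_eq_add pos θ L v
  by_cases hD : 1 + e₀ * e₁ = 0
  · have hL : isingMarginal pos θ L = 0 := by
      rw [hsum, hK, hK]
      push_cast
      linear_combination (2 * s * r) * hD
    have n1 := isingMarginal_nonneg pos hθ ((v, 1) :: L)
    have n2 := isingMarginal_nonneg pos hθ ((v, -1) :: L)
    rw [hL, zero_mul]
    rcases Int.units_eq_one_or b with rfl | rfl <;> linarith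
  · rw [hsum, hK, hK, hK]
    push_cast
    field_simp
    ring

/-! ### Filtering in the switch-reset model -/

open Classical in
/-- The transition kernel of the switch-reset process on labelings. -/
noncomputable def resetKernel {n : ℕ} (pos : Fin n ≃ Fin n) (α θ : ℝ)
    (u u' : Fin n → ℤˣ) : ℝ :=
  α * isingProb pos θ u' + (1 - α) * if u' = u then 1 else 0

open Classical in
/-- The indicator that the labeling `u` agrees with the `j`-th pair of `D`, if there is one. -/
noncomputable def agreesAt {n : ℕ} (D : List (Fin n × ℤˣ)) (j : ℕ) (u : Fin n → ℤˣ) : ℝ :=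
  if ∀ x, D[j]? = some x → u x.1 = x.2 then 1 else 0

/-- The joint probability of the pairs in `D` and of `u` being the labeling that follows them. -/
noncomputable def resetFilter {n : ℕ} (pos : Fin n ≃ Fin n) (α θ : ℝ)
    (D : List (Fin n × ℤˣ)) : (Fin n → ℤˣ) → ℝ :=
  forwardMessage (isingProb pos θ) (resetKernel pos α θ) (agreesAt D) D.length

theorem switchReset_eq_prod {n : ℕ} (pos : Fin n ≃ Fin n) (α θ : ℝ) {m : ℕ}
    (u : Fin (m + 1) → Fin n → ℤˣ) :
    switchReset pos α θ u =
      isingProb pos θ (u 0) * ∏ j : Fin m, resetKernel pos α θ (u j.castSucc) (u j.succ) := by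
  classical
  simp only [switchReset, switchResetJoint, ← Finset.mul_sum, resetKernel]
  congr 1
  have := Finset.prod_univ_sum (fun _ : Fin m => (Finset.univ : Finset Bool)) fun j b =>
    if b = true then α * isingProb pos θ (u j.succ)
      else (1 - α) * (if u j.succ = u j.castSucc then 1 else 0)
  rw [Fintype.piFinset_univ] at this
  rw [← this]
  simp

theorem switchReset_nonneg {n : ℕ} (pos : Fin n ≃ Fin n) {α θ : ℝ}
    (hα : α ∈ Set.Icc (0 : ℝ) 1) (hθ : θ ∈ Set.Icc (0 : ℝ) 1) {m : ℕ}
    (u : Fin (m + 1) → Fin n → ℤˣ) : 0 ≤ switchReset pos α θ u := by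
  classical
  rw [switchReset_eq_prod]
  refine mul_nonneg (isingProb_nonneg pos hθ _) (Finset.prod_nonneg fun j _ => ?_)
  have h1 : 0 ≤ 1 - α := by linarith [hα.2]
  exact add_nonneg (mul_nonneg hα.1 (isingProb_nonneg pos hθ _))
    (mul_nonneg h1 (by split_ifs <;> simp))

theorem switchResetProb_nonneg {n : ℕ} (pos : Fin n ≃ Fin n) {α θ : ℝ}
    (hα : α ∈ Set.Icc (0 : ℝ) 1) (hθ : θ ∈ Set.Icc (0 : ℝ) 1) {m : ℕ}
    (E : Set (Fin (m + 1) → Fin n → ℤˣ)) : 0 ≤ switchResetProb pos α θ E := by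
  classical
  refine Finset.sum_nonneg fun u _ => ?_
  split_ifs
  exacts [switchReset_nonneg pos hα hθ u, le_rfl]

open Classical in
/-- The joint probability of the pairs in `D` and of the label `b` for `v` on the next trial. -/
noncomputable def nextLabelWeight {n : ℕ} (pos : Fin n ≃ Fin n) (α θ : ℝ)
    (D : List (Fin n × ℤˣ)) (v : Fin n) (b : ℤˣ) : ℝ :=
  ∑ u, resetFilter pos α θ D u * if u v = b then 1 else 0

theorem switchResetProb_eq_nextLabelWeight {n : ℕ} (pos : Fin n ≃ Fin n) (α θ : ℝ)
    (D : List (Fin n × ℤˣ)) (v : Fin n) (b : ℤˣ) :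
    switchResetProb pos α θ (nextLabelIs D v b ∩ agreesWith D) =
      nextLabelWeight pos α θ D v b := by
  classical
  rw [nextLabelWeight, resetFilter, ← sum_paths_eq_forwardMessage, switchResetProb]
  refine Finset.sum_congr rfl fun u _ => ?_
  have h : (if u ∈ agreesWith D then (1 : ℝ) else 0) =
      ∏ j : Fin D.length, agreesAt D j (u j.castSucc) := by
    simp only [agreesAt, Finset.prod_ite_zero, Finset.prod_const_one]
    congr 1
    simp [agreesWith]
  rw [switchReset_eq_prod, Finset.prod_mul_distrib, ← h]
  by_cases h1 : u ∈ agreesWith D <;> by_cases h2 : u (Fin.last D.length) v = b <;>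
    simp [nextLabelIs, h1, h2]

theorem resetFilter_concat {n : ℕ} (pos : Fin n ≃ Fin n) (α θ : ℝ)
    (D : List (Fin n × ℤˣ)) (v : Fin n) (b : ℤˣ) (u : Fin n → ℤˣ) [Decidable (u v = b)] :
    resetFilter pos α θ (D ++ [(v, b)]) u =
      α * nextLabelWeight pos α θ D v b * isingProb pos θ u +
        (1 - α) * (resetFilter pos α θ D u * if u v = b then 1 else 0) := by
  classical
  have hc : forwardMessage (isingProb pos θ) (resetKernel pos α θ) (agreesAt (D ++ [(v, b)]))
      D.length = resetFilter pos α θ D :=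
    forwardMessage_congr _ _ fun j hj => by
      funext a
      simp only [agreesAt, List.getElem?_append_left hj]
  have hl : ∀ a : Fin n → ℤˣ, agreesAt (D ++ [(v, b)]) D.length a =
      if a v = b then 1 else 0 := by
    intro a
    simp [agreesAt, eq_comm]
  rw [resetFilter, List.length_append, List.length_singleton, forwardMessage, hc]
  simp only [hl, resetKernel, mul_add, Finset.sum_add_distrib, nextLabelWeight,
    Finset.mul_sum, Finset.sum_mul]
  congr 1
  · exact Finset.sum_congr rfl fun a _ => by ring
  · simp only [mul_ite, mul_one, mul_zero]
    rw [Finset.sum_ite_eq]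
    by_cases h : u v = b <;> simp [h, mul_comm]

open Classical in
/-- `IsMixture pos α θ D c`: the filter is the mixture, over the trial `j` that follows the last
reset, of the Ising distributions restricted to the pairs seen from trial `j` on, with
weights `c j`. -/
def IsMixture {n : ℕ} (pos : Fin n ≃ Fin n) (α θ : ℝ) (D : List (Fin n × ℤˣ))
    (c : ℕ → ℝ) : Prop :=
  ∀ u, resetFilter pos α θ D u = ∑ j ∈ Finset.range (D.length + 1),
    c j * (isingProb pos θ u * if ∀ x ∈ D.drop j, u x.1 = x.2 then 1 else 0)

theorem isMixture_nil {n : ℕ} (pos : Fin n ≃ Fin n) (α θ : ℝ) :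
    IsMixture pos α θ [] fun _ => 1 := by
  intro u
  simp [resetFilter, forwardMessage]

theorem IsMixture.nextLabelWeight_eq {n : ℕ} {pos : Fin n ≃ Fin n} {α θ : ℝ}
    {D : List (Fin n × ℤˣ)} {c : ℕ → ℝ} (h : IsMixture pos α θ D c) (v : Fin n) (b : ℤˣ) :
    nextLabelWeight pos α θ D v b =
      ∑ j ∈ Finset.range (D.length + 1), c j * isingMarginal pos θ ((v, b) :: D.drop j) := by
  classical
  simp only [nextLabelWeight, h _, isingMarginal, Finset.mul_sum, Finset.sum_mul]
  rw [Finset.sum_comm]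
  refine Finset.sum_congr rfl fun j _ => Finset.sum_congr rfl fun u _ => ?_
  by_cases hb : u v = b <;> simp [hb]

/-- Observing a pair multiplies the old weights by the probability `1 - α` of no reset, and
adds a component for a reset after that observation. -/
theorem IsMixture.concat {n : ℕ} {pos : Fin n ≃ Fin n} {α θ : ℝ}
    {D : List (Fin n × ℤˣ)} {c : ℕ → ℝ} (h : IsMixture pos α θ D c) (v : Fin n) (b : ℤˣ) :
    IsMixture pos α θ (D ++ [(v, b)]) fun j =>
      if j ≤ D.length then (1 - α) * c j else α * nextLabelWeight pos α θ D v b := by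
  classical
  intro u
  rw [resetFilter_concat, h u, List.length_append, List.length_singleton,
    Finset.sum_range_succ _ (D.length + 1), add_comm]
  congr 1
  · rw [Finset.sum_mul, Finset.mul_sum]
    refine Finset.sum_congr rfl fun j hj => ?_
    have hj' : j ≤ D.length := Nat.lt_succ_iff.1 (Finset.mem_range.1 hj)
    beta_reduce
    rw [if_pos hj', List.drop_append_of_le_length hj']
    have hiff : (∀ x ∈ D.drop j ++ [(v, b)], u x.1 = x.2) ↔
        (∀ x ∈ D.drop j, u x.1 = x.2) ∧ u v = b := by
      rw [List.forall_mem_append, List.forall_mem_singleton]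
    by_cases h1 : ∀ x ∈ D.drop j, u x.1 = x.2 <;> by_cases h2 : u v = b <;>
      simp only [hiff, h1, h2, and_true, and_false, if_true, if_false] <;> ring
  · beta_reduce
    rw [if_neg (by omega), List.drop_eq_nil_of_le (by simp)]
    simp [mul_assoc]

theorem isingMarginal_nil {n : ℕ} (pos : Fin n ≃ Fin n) {θ : ℝ} (hn : 0 < n) :
    isingMarginal pos θ [] = 1 := by
  obtain ⟨N, rfl⟩ : ∃ N, n = N + 1 := ⟨n - 1, by omega⟩
  rw [isingMarginal_eq_forwardMessage, sum_intUnits,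
    forwardMessage_of_unconstrained θ _ fun j _ b => consistent_eq_one (by simp) b,
    forwardMessage_of_unconstrained θ _ fun j _ b => consistent_eq_one (by simp) b,
    consistent_eq_one (by simp), consistent_eq_one (by simp)]
  norm_num

theorem isingMarginal_concat {n : ℕ} (pos : Fin n ≃ Fin n) (θ : ℝ) (L : List (Fin n × ℤˣ))
    (x : Fin n × ℤˣ) : isingMarginal pos θ (L ++ [x]) = isingMarginal pos θ (x :: L) := by
  classical
  simp only [isingMarginal, List.forall_mem_append, List.forall_mem_cons, List.not_mem_nil,
    false_imp_iff, implies_true, true_and, and_comm]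

/-! ### Reasoning about programs -/

namespace RealRAM

/-- `Runs B p K s Q`: on a machine of capacity `B`, the program `p` started in state `s` halts
within `K` time steps in a state that satisfies `Q`. -/
def Runs (B : ℕ) (p : Prog) (K : ℕ) (s : State) (Q : State → Prop) : Prop :=
  ∃ k s', Exec B p s k s' ∧ k ≤ K ∧ Q s'

section Rules

variable {B K K' : ℕ} {s : State} {Q R : State → Prop}

theorem Runs.mono {p : Prog} (h : Runs B p K s R) (hK : K ≤ K') (hQ : ∀ s', R s' → Q s') :
    Runs B p K' s Q := by
  obtain ⟨k, s', h1, h2, h3⟩ := h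
  exact ⟨k, s', h1, h2.trans hK, hQ _ h3⟩

theorem Runs.skip (hK : 1 ≤ K) (h : Q s) : Runs B Prog.skip K s Q := ⟨1, s, Exec.skip s, hK, h⟩

theorem Runs.setWord {a : ℕ} {j e : WExpr} (hj : j.Fits B s) (he : e.Fits B s)
    (hK : j.cost + e.cost + 1 ≤ K) (h : Q (s.setWord a (j.eval s) (e.eval s))) :
    Runs B (Prog.setWord a j e) K s Q :=
  ⟨_, _, Exec.setWord s a j e hj he, hK, h⟩

theorem Runs.setReal {a : ℕ} {j : WExpr} {e : RExpr} (hj : j.Fits B s) (he : e.Fits B s)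
    (hK : j.cost + e.cost + 1 ≤ K) (h : Q (s.setReal a (j.eval s) (e.eval s))) :
    Runs B (Prog.setReal a j e) K s Q :=
  ⟨_, _, Exec.setReal s a j e hj he, hK, h⟩

theorem Runs.seq {p q : Prog} (K₁ K₂ : ℕ) (hK : K₁ + K₂ ≤ K)
    (h : Runs B p K₁ s fun s' => Runs B q K₂ s' Q) : Runs B (Prog.seq p q) K s Q := by
  obtain ⟨k, s', h1, h2, l, s'', h3, h4, h5⟩ := h
  exact ⟨k + l, s'', Exec.seq p q s s' s'' k l h1 h3, by omega, h5⟩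

theorem Runs.ite {c : Test} {p q : Prog} (K₁ : ℕ) (hK : c.cost + K₁ ≤ K) (hf : c.Fits B s)
    (hp : c.holds s → Runs B p K₁ s Q) (hq : ¬ c.holds s → Runs B q K₁ s Q) :
    Runs B (Prog.ite c p q) K s Q := by
  by_cases hc : c.holds s
  · obtain ⟨k, s', h1, h2, h3⟩ := hp hc
    exact ⟨_, s', Exec.iteTrue c p q s s' k hf hc h1, by omega, h3⟩
  · obtain ⟨k, s', h1, h2, h3⟩ := hq hc
    exact ⟨_, s', Exec.iteFalse c p q s s' k hf hc h1, by omega, h3⟩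

/-- A loop rule with a time bound: in the invariant `I k`, the index `k` bounds the number
of iterations that remain. -/
theorem Runs.loop {c : Test} {p : Prog} {I : ℕ → State → Prop}
    (step : ∀ k s, I k s → c.Fits B s ∧
      (c.holds s → ∃ k', k = k' + 1 ∧ Runs B p K s (I k')))
    {k : ℕ} (h : I k s) :
    Runs B (Prog.loop c p) (k * (c.cost + K) + c.cost) s
      fun s' => (∃ k', I k' s') ∧ ¬ c.holds s' := by
  induction k using Nat.strong_induction_on generalizing s with
  | _ k ih =>
    obtain ⟨hf, hs⟩ := step k s h
    by_cases hc : c.holds s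
    · obtain ⟨k', rfl, l, s', h1, h2, h3⟩ := hs hc
      obtain ⟨l', s'', h4, h5, h6⟩ := ih k' (by omega) h3
      refine ⟨_, s'', Exec.loopStep c p s s' s'' l l' hf hc h1 h4, ?_, h6⟩
      rw [add_mul, one_mul]
      omega
    · exact ⟨_, s, Exec.loopDone c p s hf hc, by omega, ⟨k, h⟩, hc⟩

end Rules

/-! ### Symbolic execution -/

@[simp] theorem State.word_setWord (s : State) (a j v a' j' : ℕ) :
    (s.setWord a j v).word a' j' = if a' = a ∧ j' = j then v else s.word a' j' := by
  by_cases h : a' = a <;> by_cases h' : j' = j <;> simp [State.setWord, Function.update, h, h']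

@[simp] theorem State.real_setWord (s : State) (a j v : ℕ) : (s.setWord a j v).real = s.real := rfl

@[simp] theorem State.real_setReal (s : State) (a j : ℕ) (x : ℝ) (a' j' : ℕ) :
    (s.setReal a j x).real a' j' = if a' = a ∧ j' = j then x else s.real a' j' := by
  by_cases h : a' = a <;> by_cases h' : j' = j <;> simp [State.setReal, Function.update, h, h']

@[simp] theorem State.word_setReal (s : State) (a j : ℕ) (x : ℝ) :
    (s.setReal a j x).word = s.word := rfl

attribute [simp] WExpr.eval RExpr.eval Test.holds WExpr.cost RExpr.cost Test.cost
  WExpr.Fits RExpr.Fits Test.Fits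

/-! ### The programs -/

/-! Memory layout. Word array 0 holds the scalars: `n` (cell 0), the queried vertex (1), its
label (2), the prediction (3), the number of mistakes (4), a loop counter (5), the distances to the
nearest constraints on both sides (6 and 7), the distance of the current constraint, also used as
the exponent in fast exponentiation (8), and the side of that constraint (9). Word array 1 is the
given table of positions. Word array 2 holds the positions of the mispredicted vertices, real
array 3 their labels. Real array 0 holds `α`, `θ`, the biases from both sides (cells 2 and 3), the
total weights of the labels `-1` and `1` (4 and 5), and the base and the accumulator of the fast
exponentiation (6 and 7). Real array 1 holds the weights of the mixture components, and cells `2 j`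
and `2 j + 1` of real array 2 the shares of the labels `-1` and `1` in the weight of
component `j`. -/

/-- A word scalar. -/
abbrev wordVar (k : ℕ) : WExpr := .load 0 (.lit k)

/-- A real scalar. -/
abbrev realVar (k : ℕ) : RExpr := .load 0 (.lit k)

/-- Fast exponentiation: multiplies the accumulator by the power of the base whose
exponent is the current distance. -/
def powerLoop : Prog :=
  .loop (.wordLt (.lit 0) (wordVar 8))
    (.seq (.ite (.wordEq (wordVar 8) (.add (.div (wordVar 8) (.lit 2)) (.div (wordVar 8) (.lit 2))))
        .skip
        (.setReal 0 (.lit 7) (.mul (realVar 7) (realVar 6))))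
      (.seq (.setWord 0 (.lit 8) (.div (wordVar 8) (.lit 2)))
        (.setReal 0 (.lit 6) (.mul (realVar 6) (realVar 6)))))

/-- The exponent loses one binary digit per iteration, so that the time is linear in the number
`k` of digits. -/
theorem runs_powerLoop {B : ℕ} (hB : 20 ≤ B) {s : State} {k : ℕ} (hd : s.word 0 8 < 2 ^ k)
    (hdB : s.word 0 8 < B) :
    Runs B powerLoop (k * 37 + 4) s fun s' =>
      s'.real 0 7 = s.real 0 7 * s.real 0 6 ^ s.word 0 8 ∧
      (∀ a j, ¬ (a = 0 ∧ j = 8) → s'.word a j = s.word a j) ∧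
      (∀ a j, ¬ (a = 0 ∧ (j = 6 ∨ j = 7)) → s'.real a j = s.real a j) := by
  refine (Runs.loop (K := 33) (I := fun k s' => s'.word 0 8 < 2 ^ k ∧ s'.word 0 8 < B ∧
    s'.real 0 7 * s'.real 0 6 ^ s'.word 0 8 = s.real 0 7 * s.real 0 6 ^ s.word 0 8 ∧
      (∀ a j, ¬ (a = 0 ∧ j = 8) → s'.word a j = s.word a j) ∧
      (∀ a j, ¬ (a = 0 ∧ (j = 6 ∨ j = 7)) → s'.real a j = s.real a j))
    ?_ ⟨hd, hdB, rfl, fun _ _ _ => rfl, fun _ _ _ => rfl⟩).mono le_rfl ?_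
  · rintro k s' ⟨h1, h2, h3, h4, h5⟩
    refine ⟨by simp; omega, fun hc => ?_⟩
    simp only [Test.holds, WExpr.eval] at hc
    obtain ⟨k', rfl⟩ : ∃ k', k = k' + 1 := ⟨k - 1, by
      rcases k with _ | k
      · simp at h1; omega
      · rfl⟩
    refine ⟨k', rfl, ?_⟩
    rw [pow_succ] at h1
    -- The two assignments after the branch, from the state the branch leaves.
    have fin : ∀ (s₁ : State), s₁.word = s'.word →
        s₁.real 0 6 = s'.real 0 6 →
        s₁.real 0 7 * (s'.real 0 6 * s'.real 0 6) ^ (s'.word 0 8 / 2) =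
          s.real 0 7 * s.real 0 6 ^ s.word 0 8 →
        (∀ a j, ¬ (a = 0 ∧ (j = 6 ∨ j = 7)) → s₁.real a j = s.real a j) →
        Runs B (.seq (.setWord 0 (.lit 8) (.div (wordVar 8) (.lit 2)))
          (.setReal 0 (.lit 6) (.mul (realVar 6) (realVar 6)))) 13 s₁ fun s' =>
          s'.word 0 8 < 2 ^ k' ∧ s'.word 0 8 < B ∧
    s'.real 0 7 * s'.real 0 6 ^ s'.word 0 8 = s.real 0 7 * s.real 0 6 ^ s.word 0 8 ∧
      (∀ a j, ¬ (a = 0 ∧ j = 8) → s'.word a j = s.word a j) ∧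
      (∀ a j, ¬ (a = 0 ∧ (j = 6 ∨ j = 7)) → s'.real a j = s.real a j) := by
      intro s₁ e1 e2 e3 e4
      refine Runs.seq 6 7 le_rfl (Runs.setWord ?_ ?_ (by simp) (Runs.setReal ?_ ?_ (by simp) ?_))
      · simp; omega
      · simp [e1]; omega
      · simp; omega
      · simp; omega
      · simp only [WExpr.eval, RExpr.eval, State.word_setReal, State.word_setWord,
          State.real_setReal, State.real_setWord]
        simp [e1, e2, e3]
        refine ⟨by omega, by omega, ?_, ?_⟩
        · intro a j h
          rw [if_neg (by tauto)]
          exact h4 a j (by tauto)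
        · intro a j h
          rw [if_neg (by tauto)]
          exact e4 a j (by tauto)
    refine Runs.seq 20 13 le_rfl (Runs.ite 7 (by simp) (by simp; omega) (fun hc => ?_) fun hc => ?_)
    · refine Runs.skip (by norm_num) (fin s' rfl rfl ?_ h5)
      simp only [Test.holds, WExpr.eval] at hc
      rw [← h3, ← pow_two, ← pow_mul, show 2 * (s'.word 0 8 / 2) = s'.word 0 8 by omega]
    · refine Runs.setReal (by simp; omega) (by simp; omega) (by simp) (fin _ rfl ?_ ?_ ?_)
      · simp
      · simp only [Test.holds, WExpr.eval] at hc
        rw [← h3, ← pow_two, ← pow_mul]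
        conv_rhs => rw [show s'.word 0 8 = 2 * (s'.word 0 8 / 2) + 1 by omega, pow_succ]
        simp
        ring
      · intro a j h
        rw [State.real_setReal, if_neg (by simp; tauto)]
        exact h5 a j h
  · rintro s' ⟨⟨k', h1, h2, h3, h4, h5⟩, hc⟩
    have : s'.word 0 8 = 0 := by simpa using hc
    rw [this] at h3
    exact ⟨by simpa using h3, h4, h5⟩

/-! ### Nearest constraints and label shares in memory -/

/-- The memory during a trial with query `v`, after the mispredicted pairs `D`: the input, the
history of the mispredicted pairs, and the weights `W` of the mixture components. -/
structure Represents {n : ℕ} (pos : Fin n ≃ Fin n) (α θ : ℝ) (D : List (Fin n × ℤˣ)) (v : Fin n)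
    (W : ℕ → ℝ) (s : State) : Prop where
  size : s.word 0 0 = n
  query : s.word 0 1 = v
  length : s.word 0 4 = D.length
  position : ∀ w : Fin n, s.word 1 w = pos w
  place : ∀ (j : ℕ) (h : j < D.length), s.word 2 j = pos D[j].1
  alpha : s.real 0 0 = α
  theta : s.real 0 1 = θ
  label : ∀ (j : ℕ) (h : j < D.length), s.real 3 j = ((D[j].2 : ℤ) : ℝ)
  weight : ∀ j ≤ D.length, s.real 1 j = W j

/-- Only working cells differ: scalars other than the input and the number of mistakes,
and the shares of the two labels. -/
def SameRecord (s s' : State) : Prop :=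
  (∀ a j, ¬ (a = 0 ∧ (j = 2 ∨ j = 3 ∨ 5 ≤ j)) → s'.word a j = s.word a j) ∧
  (∀ a j, ¬ (a = 0 ∧ 2 ≤ j) → a ≠ 2 → s'.real a j = s.real a j)

theorem Represents.of_sameRecord {n : ℕ} {pos : Fin n ≃ Fin n} {α θ : ℝ}
    {D : List (Fin n × ℤˣ)} {v : Fin n} {W : ℕ → ℝ} {s s' : State}
    (h : Represents pos α θ D v W s) (hs : SameRecord s s') : Represents pos α θ D v W s' where
  size := by rw [hs.1 _ _ (by omega), h.size]
  query := by rw [hs.1 _ _ (by omega), h.query]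
  length := by rw [hs.1 _ _ (by omega), h.length]
  position w := by rw [hs.1 _ _ (by omega), h.position]
  place j hj := by rw [hs.1 _ _ (by omega), h.place j hj]
  alpha := by rw [hs.2 _ _ (by omega) (by omega), h.alpha]
  theta := by rw [hs.2 _ _ (by omega) (by omega), h.theta]
  label j hj := by rw [hs.2 _ _ (by omega) (by omega), h.label j hj]
  weight j hj := by rw [hs.2 _ _ (by omega) (by omega), h.weight j hj]

/-- The position of the queried vertex. -/
abbrev queryPos : WExpr := .load 1 (wordVar 1)

/-- The position of the mispredicted vertex to which the loop counter points. -/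
abbrev pastPos : WExpr := .load 2 (wordVar 5)

/-- Adds the pair to which the loop counter points to the constraints, updating the distance and
the bias on its side if it is closer to the query than the constraints so far. -/
def nearestStep : Prog :=
  .seq (.setWord 0 (.lit 8) (.add (.sub queryPos pastPos) (.sub pastPos queryPos)))
  (.seq (.ite (.wordLt queryPos pastPos) (.setWord 0 (.lit 9) (.lit 1))
    (.setWord 0 (.lit 9) (.lit 0)))
  (.ite (.wordLt (wordVar 8) (.load 0 (.add (.lit 6) (wordVar 9))))
    (.seq (.setWord 0 (.add (.lit 6) (wordVar 9)) (wordVar 8))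
    (.seq (.setReal 0 (.lit 7) (.load 3 (wordVar 5)))
    (.seq (.setReal 0 (.lit 6) (.sub (.lit 1) (.mul (.lit 2) (realVar 1))))
    (.seq powerLoop
    (.setReal 0 (.add (.lit 2) (wordVar 9)) (realVar 7))))))
    .skip))

/-- The distances and biases in memory are those of the nearest constraints in `L` on the two
sides of position `q`. -/
def HoldsNearest {n : ℕ} (pos : Fin n ≃ Fin n) (θ : ℝ) (q : ℕ) (L : List (Fin n × ℤˣ))
    (s : State) : Prop :=
  ∀ σ < 2, IsNearest pos θ q σ L (s.word 0 (6 + σ)) (s.real 0 (2 + σ))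

section

variable {n : ℕ} {pos : Fin n ≃ Fin n} {α θ : ℝ} {D : List (Fin n × ℤˣ)} {v : Fin n}
  {W : ℕ → ℝ} {s : State} {B j k : ℕ}

/-- One constraint is added at the cost of one exponentiation. -/
theorem runs_nearestStep (hB : n + 2 * D.length + 20 ≤ B) (hk : n ≤ 2 ^ k)
    (hs : Represents pos α θ D v W s) (hj : j < D.length) (hc : s.word 0 5 = j)
    (hN : HoldsNearest pos θ (pos v) (D.drop (j + 1)) s) :
    Runs B nearestStep (k * 37 + 80) s fun s' =>
      HoldsNearest pos θ (pos v) (D.drop j) s' ∧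
      (∀ a i, ¬ (a = 0 ∧ 6 ≤ i) → s'.word a i = s.word a i) ∧
      (∀ a i, ¬ (a = 0 ∧ (i = 2 ∨ i = 3 ∨ i = 6 ∨ i = 7)) → s'.real a i = s.real a i) := by
  obtain ⟨x, hx⟩ : ∃ x, x = D[j] := ⟨_, rfl⟩
  have hdrop : D.drop j = x :: D.drop (j + 1) := by rw [hx, List.drop_eq_getElem_cons hj]
  have hpv := (pos v).isLt
  have hpx := (pos x.1).isLt
  have hv := v.isLt
  have hP : s.word 1 v = pos v := hs.position v
  have hH : s.word 2 j = pos x.1 := by rw [hs.place j hj, hx]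
  have hY : s.real 3 j = ((x.2 : ℤ) : ℝ) := by rw [hs.label j hj, hx]
  have hv1 := hs.query
  have hθ := hs.theta
  obtain ⟨σ, hσ⟩ : ∃ σ, σ = if (pos v : ℕ) < pos x.1 then 1 else 0 := ⟨_, rfl⟩
  have hσ2 : σ < 2 := by rw [hσ]; split_ifs <;> omega
  obtain ⟨d, hd⟩ : ∃ d, d = ((pos v : ℕ) - pos x.1) + (pos x.1 - pos v) := ⟨_, rfl⟩
  have hdn : d < n := by omega
  have hdist := (hN σ hσ2).dist_le hpv
  -- The state once distance and side of the constraint are known.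
  suffices main : ∀ s₁ : State, s₁.word 0 8 = d → s₁.word 0 9 = σ →
      (∀ a i, ¬ (a = 0 ∧ (i = 8 ∨ i = 9)) → s₁.word a i = s.word a i) → s₁.real = s.real →
      Runs B (.ite (.wordLt (wordVar 8) (.load 0 (.add (.lit 6) (wordVar 9))))
        (.seq (.setWord 0 (.add (.lit 6) (wordVar 9)) (wordVar 8))
        (.seq (.setReal 0 (.lit 7) (.load 3 (wordVar 5)))
        (.seq (.setReal 0 (.lit 6) (.sub (.lit 1) (.mul (.lit 2) (realVar 1))))
        (.seq powerLoop
        (.setReal 0 (.add (.lit 2) (wordVar 9)) (realVar 7))))))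
        .skip) (k * 37 + 50) s₁ fun s' =>
          HoldsNearest pos θ (pos v) (D.drop j) s' ∧
          (∀ a i, ¬ (a = 0 ∧ 6 ≤ i) → s'.word a i = s.word a i) ∧
          (∀ a i, ¬ (a = 0 ∧ (i = 2 ∨ i = 3 ∨ i = 6 ∨ i = 7)) → s'.real a i = s.real a i) by
    refine Runs.seq 17 (k * 37 + 63) (by omega) (Runs.setWord ?_ ?_ (by simp) ?_)
    · simp; omega
    · simp [hc, hv1, hP, hH]; omega
    refine Runs.seq 11 (k * 37 + 50) (by omega) (Runs.ite 4 (by simp) ?_ (fun h => ?_) fun h => ?_)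
    · simp [hc, hv1, hP, hH]; omega
    · refine Runs.setWord (by simp; omega) (by simp; omega) (by simp) (main _ ?_ ?_ ?_ ?_)
      · simp [hc, hv1, hP, hH, hd]
      · simp [hc, hv1, hP, hH] at h
        simp [hσ, h]
      · intro a i hi
        simp only [State.word_setWord, WExpr.eval]
        rw [if_neg (by tauto), if_neg (by tauto)]
      · simp
    · refine Runs.setWord (by simp; omega) (by simp; omega) (by simp) (main _ ?_ ?_ ?_ ?_)
      · simp [hc, hv1, hP, hH, hd]
      · simp [hc, hv1, hP, hH] at h
        rw [hσ, if_neg (by simpa using h)]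
        simp
      · intro a i hi
        simp only [State.word_setWord, WExpr.eval]
        rw [if_neg (by tauto), if_neg (by tauto)]
      · simp
  intro s₁ h8 h9 hw hr
  have w5 : s₁.word 0 5 = j := by rw [hw _ _ (by omega), hc]
  have wσ : ∀ τ < 2, s₁.word 0 (6 + τ) = s.word 0 (6 + τ) := fun τ hτ => hw _ _ (by omega)
  have e9 : ¬ (8 = 6 + σ) := by omega
  have e9' : ¬ (9 = 6 + σ) := by omega
  have e5 : ¬ (5 = 6 + σ) := by omega
  refine Runs.ite (k * 37 + 38) (by simp; omega) ?_ (fun h => ?_) fun h => ?_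
  · simp [h8, h9, wσ σ hσ2]; omega
  · simp only [Test.holds, WExpr.eval, h8, h9, wσ σ hσ2] at h
    refine Runs.seq 7 (k * 37 + 31) (by omega) (Runs.setWord ?_ ?_ (by simp) ?_)
    · simp [h9]; omega
    · simp [h8]; omega
    refine Runs.seq 6 (k * 37 + 25) (by omega) (Runs.setReal ?_ ?_ (by simp) ?_)
    · simp; omega
    · simp [w5, h9, e5]; omega
    refine Runs.seq 10 (k * 37 + 15) (by omega) (Runs.setReal ?_ ?_ (by simp) ?_)
    · simp; omega
    · simp; omega
    refine Runs.seq (k * 37 + 4) 10 (by omega)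
      ((runs_powerLoop (k := k) (by omega) ?_ ?_).mono le_rfl ?_)
    · simp [h8, h9, e9]; omega
    · simp [h8, h9, e9]; omega
    rintro s₂ ⟨p1, p2, p3⟩
    have q7 : s₂.real 0 7 = ((x.2 : ℤ) : ℝ) * (1 - 2 * θ) ^ d := by
      rw [p1]; simp [h8, h9, e9, e5, w5, hr, hY, hθ]
    have q9 : s₂.word 0 9 = σ := by
      rw [p2 _ _ (by omega)]; simp [h8, h9, e9']
    have qw : ∀ a i, ¬ (a = 0 ∧ i = 8) →
        s₂.word a i = if a = 0 ∧ i = 6 + σ then d else s₁.word a i := by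
      intro a i hi
      rw [p2 a i hi]; simp [h8, h9]
    have qr : ∀ a i, ¬ (a = 0 ∧ (i = 6 ∨ i = 7)) → s₂.real a i = s.real a i := by
      intro a i hi
      rw [p3 a i hi]
      simp only [WExpr.eval, State.real_setReal, State.real_setWord, hr]
      rw [if_neg (by tauto), if_neg (by tauto)]
    refine Runs.setReal ?_ ?_ (by simp) ⟨?_, ?_, ?_⟩
    · simp [q9]; omega
    · simp; omega
    · intro τ hτ
      have := hN τ hτ
      simp only [WExpr.eval, RExpr.eval, State.word_setReal, State.real_setReal, q9, q7]
      rw [qw _ _ (by omega), hdrop]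
      by_cases hτσ : τ = σ
      · subst hτσ
        simpa [hd] using this.cons_closer x hσ.symm (by rwa [← hd])
      · rw [if_neg (by omega), if_neg (by omega), wσ τ hτ, qr _ _ (by omega)]
        exact this.cons_otherSide x fun h' => hτσ (by rw [hσ, ← h'])
    · intro a i hi
      simp only [State.word_setReal]
      rw [qw _ _ (by omega), if_neg (by omega), hw _ _ (by omega)]
    · intro a i hi
      simp only [State.real_setReal, WExpr.eval, q9]
      rw [if_neg (by omega), qr _ _ (by omega)]
  · simp only [Test.holds, WExpr.eval, h8, h9, wσ σ hσ2] at h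
    refine Runs.skip (by omega) ⟨?_, ?_, ?_⟩
    · intro τ hτ
      have := hN τ hτ
      rw [hdrop, wσ τ hτ, hr]
      by_cases hτσ : τ = σ
      · subst hτσ
        exact this.cons_farther x hpv (by rwa [← hd])
      · exact this.cons_otherSide x fun h' => hτσ (by rw [hσ, ← h'])
    · intro a i hi
      exact hw _ _ (by omega)
    · intro a i hi
      rw [hr]

/-- The given real expression, with the sign of the label `b`. -/
def signed (b : ℤˣ) (e : RExpr) : RExpr := if b = 1 then e else .sub (.lit 0) e

theorem eval_signed (b : ℤˣ) (e : RExpr) (s : State) :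
    (signed b e).eval s = ((b : ℤ) : ℝ) * e.eval s := by
  rcases Int.units_eq_one_or b with rfl | rfl <;> simp [signed]

theorem cost_signed_le (b : ℤˣ) (e : RExpr) : (signed b e).cost ≤ e.cost + 2 := by
  rcases Int.units_eq_one_or b with rfl | rfl <;> simp [signed]
  omega

theorem fits_signed (b : ℤˣ) {e : RExpr} (h : e.Fits B s) : (signed b e).Fits B s := by
  rcases Int.units_eq_one_or b with rfl | rfl <;> simp [signed, h]

theorem labelWord_le_one (b : ℤˣ) : labelWord b ≤ 1 := by
  rw [labelWord]; split_ifs <;> omega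

theorem labelWord_injective : Function.Injective labelWord := by
  intro a b h
  rcases Int.units_eq_one_or a with rfl | rfl <;> rcases Int.units_eq_one_or b with rfl | rfl <;>
    simp_all [labelWord]

/-- The conditional probability of the label `b`, computed from the biases from both sides. -/
def conditional (b : ℤˣ) : RExpr :=
  .div (.mul (.add (.lit 1) (signed b (realVar 2))) (.add (.lit 1) (signed b (realVar 3))))
    (.mul (.lit 2) (.add (.lit 1) (.mul (realVar 2) (realVar 3))))

/-- The cell for the share of the label `b` in the component to which the loop counter points. -/
def shareCell (b : ℤˣ) : WExpr := .add (.add (wordVar 5) (wordVar 5)) (.lit (labelWord b))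

/-- Computes the share of the label `b` in the current component, and adds it to the
total for `b`. -/
def shareStep (b : ℤˣ) : Prog :=
  .seq (.setReal 2 (shareCell b) (.mul (.load 1 (wordVar 5)) (conditional b)))
    (.setReal 0 (.lit (4 + labelWord b))
      (.add (.load 0 (.lit (4 + labelWord b))) (.load 2 (shareCell b))))

/-- If component `j` has weight `c` times the probability of its constraints, then the computed share
is `c` times the probability of these constraints and the label `b` for the query. -/
theorem runs_shareStep (hB : n + 2 * D.length + 20 ≤ B) (hθ : θ ∈ Set.Icc (0 : ℝ) 1)
    (hs : Represents pos α θ D v W s) (hj : j ≤ D.length) (hc : s.word 0 5 = j)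
    (hN : HoldsNearest pos θ (pos v) (D.drop j) s) {c : ℝ}
    (hW : W j = c * isingMarginal pos θ (D.drop j)) (b : ℤˣ) :
    Runs B (shareStep b) 60 s fun s' =>
      s'.real 2 (2 * j + labelWord b) = c * isingMarginal pos θ ((v, b) :: D.drop j) ∧
      s'.real 0 (4 + labelWord b) =
        s.real 0 (4 + labelWord b) + c * isingMarginal pos θ ((v, b) :: D.drop j) ∧
      s'.word = s.word ∧
      (∀ a i, ¬ (a = 0 ∧ i = 4 + labelWord b) → ¬ (a = 2 ∧ i = 2 * j + labelWord b) →
        s'.real a i = s.real a i) := by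
  have hb := labelWord_le_one b
  have hp := isingMarginal_mul_conditional hθ (hN 0 (by omega)) (hN 1 (by omega)) b
  have hval : s.real 1 j * (conditional b).eval s =
      c * isingMarginal pos θ ((v, b) :: D.drop j) := by
    rw [hs.weight j hj, hW, mul_assoc, ← hp]
    simp [conditional, eval_signed]
  have c2 := cost_signed_le b (realVar 2)
  have c3 := cost_signed_le b (realVar 3)
  have cell : ∀ s' : State, s'.word = s.word → (shareCell b).eval s' = 2 * j + labelWord b := by
    intro s' h
    simp [shareCell, h, hc]
    omega
  have cellFits : ∀ s' : State, s'.word = s.word → (shareCell b).Fits B s' := by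
    intro s' h
    simp [shareCell, h, hc]
    omega
  have f2 : (realVar 2).Fits B s := by simp; omega
  have f3 : (realVar 3).Fits B s := by simp; omega
  refine Runs.seq 40 20 le_rfl (Runs.setReal (cellFits _ rfl) ?_ ?_
    (Runs.setReal ?_ ?_ ?_ ⟨?_, ?_, ?_, ?_⟩))
  · refine ⟨by simp [hc]; omega, ⟨⟨trivial, fits_signed b f2⟩, trivial, fits_signed b f3⟩, ?_⟩
    exact ⟨trivial, trivial, f2, f3⟩
  · simp [shareCell, conditional] at c2 c3 ⊢
    omega
  · simp; omega
  · exact ⟨by simp; omega, cellFits _ (by simp)⟩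
  · simp [shareCell]
  · simp [cell, hc, hval]
  · simp [cell, hc, hval]
    exact fun h => absurd (cell _ (by simp)) h
  · simp
  · intro a i h1 h2
    simp only [State.real_setReal, WExpr.eval, cell s rfl]
    rw [if_neg h1, if_neg h2]

end

/-! ### Prediction and update -/

/-- For the components `i ≥ k` of the mixture, memory holds the joint weights with each label of
`v`, and their totals. -/
def HoldsShares {n : ℕ} (pos : Fin n ≃ Fin n) (θ : ℝ) (D : List (Fin n × ℤˣ)) (v : Fin n)
    (c : ℕ → ℝ) (k : ℕ) (s : State) : Prop :=
  ∀ b : ℤˣ,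
    (∀ i, k ≤ i → i ≤ D.length →
      s.real 2 (2 * i + labelWord b) = c i * isingMarginal pos θ ((v, b) :: D.drop i)) ∧
    s.real 0 (4 + labelWord b) =
      ∑ i ∈ Finset.Ico k (D.length + 1), c i * isingMarginal pos θ ((v, b) :: D.drop i)

/-- Runs through the mixture components from the latest to the earliest, adding one constraint at
a time. The latest component has no constraints. -/
def predictLoop : Prog :=
  .loop (.wordLt (.lit 0) (wordVar 5))
    (.seq (.setWord 0 (.lit 5) (.sub (wordVar 5) (.lit 1)))
    (.seq (.ite (.wordLt (wordVar 5) (wordVar 4)) nearestStep .skip)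
    (.seq (shareStep 1) (shareStep (-1)))))

/-- Initializes the scan. The weight of the only component is set as long as there are no
mistakes. -/
def predictInit : Prog :=
  .seq (.ite (.wordEq (wordVar 4) (.lit 0)) (.setReal 1 (.lit 0) (.lit 1)) .skip)
  (.seq (.setWord 0 (.lit 6) (wordVar 0))
  (.seq (.setWord 0 (.lit 7) (wordVar 0))
  (.seq (.setReal 0 (.lit 2) (.lit 0))
  (.seq (.setReal 0 (.lit 3) (.lit 0))
  (.seq (.setReal 0 (.lit 4) (.lit 0))
  (.seq (.setReal 0 (.lit 5) (.lit 0))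
  (.setWord 0 (.lit 5) (.add (wordVar 4) (.lit 1)))))))))

/-- The program run at the query. -/
def predictProg : Prog :=
  .seq predictInit
  (.seq predictLoop
  (.ite (.realLt (realVar 5) (realVar 4))
    (.setWord 0 (.lit 3) (.lit 0)) (.setWord 0 (.lit 3) (.lit 1))))

/-- Makes the joint weights with the revealed label the new weights of the components. -/
def reweightLoop : Prog :=
  .loop (.wordLt (wordVar 5) (.add (wordVar 4) (.lit 1)))
    (.seq (.setReal 1 (wordVar 5) (.mul (.sub (.lit 1) (realVar 0))
      (.load 2 (.add (.add (wordVar 5) (wordVar 5)) (wordVar 2)))))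
    (.setWord 0 (.lit 5) (.add (wordVar 5) (.lit 1))))

/-- The program run when the label is revealed. -/
def updateProg : Prog :=
  .ite (.wordEq (wordVar 3) (wordVar 2)) .skip
  (.seq (.setWord 0 (.lit 5) (.lit 0))
  (.seq reweightLoop
  (.seq (.setReal 1 (.add (wordVar 4) (.lit 1))
    (.mul (realVar 0) (.load 0 (.add (.lit 4) (wordVar 2)))))
  (.seq (.setWord 2 (wordVar 4) queryPos)
  (.seq (.ite (.wordEq (wordVar 2) (.lit 1)) (.setReal 3 (wordVar 4) (.lit 1))
    (.setReal 3 (wordVar 4) (.sub (.lit 0) (.lit 1))))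
  (.setWord 0 (.lit 4) (.add (wordVar 4) (.lit 1))))))))

section

variable {n : ℕ} {pos : Fin n ≃ Fin n} {α θ : ℝ} {D : List (Fin n × ℤˣ)} {v : Fin n}
  {W c : ℕ → ℝ} {s : State} {B k : ℕ}

theorem SameRecord.trans {s s' s'' : State} (h : SameRecord s s') (h' : SameRecord s' s'') :
    SameRecord s s'' :=
  ⟨fun a j hj => (h'.1 a j hj).trans (h.1 a j hj),
    fun a j h1 h2 => (h'.2 a j h1 h2).trans (h.2 a j h1 h2)⟩

theorem sameRecord_setWord {a i x : ℕ} (ha : a = 0) (hi : i = 2 ∨ i = 3 ∨ 5 ≤ i) :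
    SameRecord s (s.setWord a i x) := by
  refine ⟨fun a' j h => ?_, fun _ _ _ _ => rfl⟩
  rw [State.word_setWord, if_neg (by omega)]

theorem sameRecord_setReal {i : ℕ} {x : ℝ} (hi : 2 ≤ i) :
    SameRecord s (s.setReal 0 i x) := by
  refine ⟨fun _ _ _ => rfl, fun a' j h _ => ?_⟩
  rw [State.real_setReal, if_neg (by omega)]

theorem runs_predictLoop (hB : n + 2 * D.length + 20 ≤ B) (hk : n ≤ 2 ^ k)
    (hθ : θ ∈ Set.Icc (0 : ℝ) 1) (hs : Represents pos α θ D v W s)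
    (hW : ∀ j ≤ D.length, W j = c j * isingMarginal pos θ (D.drop j))
    (hc : s.word 0 5 = D.length + 1) (hN : HoldsNearest pos θ (pos v) [] s)
    (hA : HoldsShares pos θ D v c (D.length + 1) s) :
    Runs B predictLoop ((D.length + 1) * (k * 37 + 220) + 4) s fun s' =>
      Represents pos α θ D v W s' ∧ HoldsShares pos θ D v c 0 s' := by
  refine (Runs.loop (K := k * 37 + 216) (k := D.length + 1)
    (I := fun j s' => Represents pos α θ D v W s' ∧ s'.word 0 5 = j ∧ j ≤ D.length + 1 ∧
      HoldsNearest pos θ (pos v) (D.drop j) s' ∧ HoldsShares pos θ D v c j s') ?_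
    ⟨hs, hc, le_rfl, by rwa [List.drop_eq_nil_of_le (by omega)], hA⟩).mono ?_ ?_
  · rintro j s₁ ⟨h1, h2, h3, h4, h5⟩
    refine ⟨by simp; omega, fun hlt => ?_⟩
    simp only [Test.holds, WExpr.eval, h2] at hlt
    obtain ⟨j, rfl⟩ : ∃ i, j = i + 1 := ⟨j - 1, by omega⟩
    refine ⟨j, rfl, ?_⟩
    have hjm : j ≤ D.length := by omega
    have hb1 : labelWord 1 = 1 := rfl
    have hb0 : labelWord (-1) = 0 := rfl
    -- Once the constraints are up to date, the shares of both labels are computed.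
    have score : ∀ s₂ : State, Represents pos α θ D v W s₂ → s₂.word 0 5 = j →
        HoldsNearest pos θ (pos v) (D.drop j) s₂ → HoldsShares pos θ D v c (j + 1) s₂ →
        Runs B (.seq (shareStep 1) (shareStep (-1))) 120 s₂ fun s' =>
          Represents pos α θ D v W s' ∧ s'.word 0 5 = j ∧ j ≤ D.length + 1 ∧
          HoldsNearest pos θ (pos v) (D.drop j) s' ∧ HoldsShares pos θ D v c j s' := by
      intro s₂ g1 g2 g3 g4
      refine Runs.seq 60 60 le_rfl
        ((runs_shareStep hB hθ g1 hjm g2 g3 (hW j hjm) 1).mono le_rfl ?_)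
      rintro s₃ ⟨p1, p2, p3, p4⟩
      rw [hb1] at p1 p2 p4
      have r3 : SameRecord s₂ s₃ :=
        ⟨fun a i _ => by rw [p3], fun a i h h' => p4 a i (by omega) (by omega)⟩
      have n3 : HoldsNearest pos θ (pos v) (D.drop j) s₃ := by
        intro σ hσ
        rw [p3, p4 _ _ (by omega) (by omega)]
        exact g3 σ hσ
      refine (runs_shareStep hB hθ (g1.of_sameRecord r3) hjm (by rw [p3, g2]) n3
        (hW j hjm) (-1)).mono le_rfl ?_
      rintro s₄ ⟨q1, q2, q3, q4⟩
      rw [hb0] at q1 q2 q4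
      have r4 : SameRecord s₃ s₄ :=
        ⟨fun a i _ => by rw [q3], fun a i h h' => q4 a i (by omega) (by omega)⟩
      refine ⟨(g1.of_sameRecord r3).of_sameRecord r4, by rw [q3, p3, g2], by omega, ?_, ?_⟩
      · intro σ hσ
        rw [q3, q4 _ _ (by omega) (by omega)]
        exact n3 σ hσ
      · intro b
        obtain ⟨a1, a2⟩ := g4 b
        rw [Finset.sum_eq_sum_Ico_succ_bot (by omega), ← a2]
        rcases Int.units_eq_one_or b with rfl | rfl
        · rw [hb1] at a1 a2 ⊢
          refine ⟨fun i hi hi' => ?_, ?_⟩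
          · rw [q4 _ _ (by omega) (by omega)]
            rcases hi.eq_or_lt with rfl | hlt
            · exact p1
            · rw [p4 _ _ (by omega) (by omega)]
              exact a1 i hlt hi'
          · rw [q4 _ _ (by omega) (by omega), p2, add_comm]
        · rw [hb0] at a1 a2 ⊢
          refine ⟨fun i hi hi' => ?_, ?_⟩
          · rcases hi.eq_or_lt with rfl | hlt
            · exact q1
            · rw [q4 _ _ (by omega) (by omega), p4 _ _ (by omega) (by omega)]
              exact a1 i hlt hi'
          · rw [q2, p4 _ _ (by omega) (by omega), add_comm]
    refine Runs.seq 6 (k * 37 + 210) (by omega) (Runs.setWord ?_ ?_ (by simp) ?_)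
    · simp; omega
    · simp [h2]; omega
    have e1 : (s₁.setWord 0 5 j).word 0 5 = j := by simp
    have r1 : SameRecord s₁ (s₁.setWord 0 5 j) := sameRecord_setWord rfl (by omega)
    have ev : (WExpr.sub (wordVar 5) (.lit 1)).eval s₁ = j := by simp [h2]
    have n1 : HoldsNearest pos θ (pos v) (D.drop (j + 1)) (s₁.setWord 0 5 j) := by
      intro σ hσ
      rw [State.real_setWord, State.word_setWord, if_neg (by omega)]
      exact h4 σ hσ
    have a1 : HoldsShares pos θ D v c (j + 1) (s₁.setWord 0 5 j) := h5
    have g1 := h1.of_sameRecord r1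
    rw [ev]
    simp only [WExpr.eval]
    generalize s₁.setWord 0 5 j = s₂ at *
    have g4 := g1.length
    refine Runs.seq (k * 37 + 90) 120 (by omega) (Runs.ite (k * 37 + 80) (by simp; omega) ?_
      (fun h => ?_) fun h => ?_)
    · simp [e1, g4]; omega
    · simp only [Test.holds, WExpr.eval, e1, g4] at h
      refine (runs_nearestStep hB hk g1 h e1 n1).mono le_rfl ?_
      rintro s₃ ⟨p1, p2, p3⟩
      refine score s₃ (g1.of_sameRecord ⟨fun a i h => p2 a i (by omega),
        fun a i h h' => p3 a i (by omega)⟩) (by rw [p2 _ _ (by omega), e1]) p1 fun b => ?_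
      have hb := labelWord_le_one b
      refine ⟨fun i hi hi' => ?_, ?_⟩
      · rw [p3 _ _ (by omega)]
        exact (a1 b).1 i hi hi'
      · rw [p3 _ _ (by omega)]
        exact (a1 b).2
    · simp only [Test.holds, WExpr.eval, e1, g4] at h
      refine Runs.skip (by omega) (score s₂ g1 e1 ?_ a1)
      rw [List.drop_eq_nil_of_le (by omega)] at n1 ⊢
      exact n1
  · simp
    ring_nf
    omega
  · rintro s' ⟨⟨j, h1, h2, -, -, h5⟩, h⟩
    have hj : j = 0 := by
      simp only [Test.holds, WExpr.eval, h2] at h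
      omega
    subst hj
    exact ⟨h1, h5⟩

theorem runs_predictInit (hB : n + 2 * D.length + 20 ≤ B) (hs : Represents pos α θ D v W s)
    (hW : D = [] ∨ IsMixture pos α θ D c ∧
      ∀ j ≤ D.length, W j = c j * isingMarginal pos θ (D.drop j)) :
    Runs B predictInit 50 s fun s' =>
      ∃ W' c' : ℕ → ℝ, Represents pos α θ D v W' s' ∧ IsMixture pos α θ D c' ∧
        (∀ j ≤ D.length, W' j = c' j * isingMarginal pos θ (D.drop j)) ∧
        s'.word 0 5 = D.length + 1 ∧ HoldsNearest pos θ (pos v) [] s' ∧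
        HoldsShares pos θ D v c' (D.length + 1) s' := by
  have hm := hs.length
  have hn := hs.size
  have hv := v.isLt
  -- The initialization after the weight of the only component has been set, if need be.
  have rest : ∀ (s₁ : State) (W' c' : ℕ → ℝ), Represents pos α θ D v W' s₁ →
      IsMixture pos α θ D c' →
      (∀ j ≤ D.length, W' j = c' j * isingMarginal pos θ (D.drop j)) →
      Runs B (.seq (.setWord 0 (.lit 6) (wordVar 0))
        (.seq (.setWord 0 (.lit 7) (wordVar 0))
        (.seq (.setReal 0 (.lit 2) (.lit 0))
        (.seq (.setReal 0 (.lit 3) (.lit 0))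
        (.seq (.setReal 0 (.lit 4) (.lit 0))
        (.seq (.setReal 0 (.lit 5) (.lit 0))
        (.setWord 0 (.lit 5) (.add (wordVar 4) (.lit 1))))))))) 35 s₁ fun s' =>
      ∃ W' c' : ℕ → ℝ, Represents pos α θ D v W' s' ∧ IsMixture pos α θ D c' ∧
        (∀ j ≤ D.length, W' j = c' j * isingMarginal pos θ (D.drop j)) ∧
        s'.word 0 5 = D.length + 1 ∧ HoldsNearest pos θ (pos v) [] s' ∧
        HoldsShares pos θ D v c' (D.length + 1) s' := by
    intro s₁ W' c' g1 g2 g3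
    have hm := g1.length
    have hn := g1.size
    refine Runs.seq 4 31 le_rfl (Runs.setWord (by simp; omega) (by simp [hn]; omega) (by simp) ?_)
    refine Runs.seq 4 27 le_rfl (Runs.setWord (by simp; omega) (by simp [hn]; omega) (by simp) ?_)
    refine Runs.seq 3 24 le_rfl (Runs.setReal (by simp; omega) (by simp) (by simp) ?_)
    refine Runs.seq 3 21 le_rfl (Runs.setReal (by simp; omega) (by simp) (by simp) ?_)
    refine Runs.seq 3 18 le_rfl (Runs.setReal (by simp; omega) (by simp) (by simp) ?_)
    refine Runs.seq 3 15 le_rfl (Runs.setReal (by simp; omega) (by simp) (by simp) ?_)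
    refine Runs.setWord (by simp; omega) (by simp [hm]; omega) (by simp)
      ⟨W', c', g1.of_sameRecord ?_, g2, g3, by simp [hm], ?_, ?_⟩
    · simp only [WExpr.eval]
      exact ((((((sameRecord_setWord rfl (by omega)).trans (sameRecord_setWord rfl (by omega))).trans
        (sameRecord_setReal (by omega))).trans (sameRecord_setReal (by omega))).trans
        (sameRecord_setReal (by omega))).trans (sameRecord_setReal (by omega))).trans
        (sameRecord_setWord rfl (by omega))
    · intro σ hσ
      interval_cases σ <;> simpa [hn] using IsNearest.nil pos θ (pos v) _
    · intro b
      refine ⟨fun i hi hi' => by omega, ?_⟩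
      rcases Int.units_eq_one_or b with rfl | rfl <;> simp [labelWord]
  refine Runs.seq 15 35 le_rfl (Runs.ite 4 (by simp) (by simp [hm]; omega) (fun h => ?_) fun h => ?_)
  · simp only [Test.holds, WExpr.eval, hm] at h
    have hD : D = [] := List.eq_nil_of_length_eq_zero h
    refine Runs.setReal (by simp; omega) (by simp) (by simp)
      (rest _ (fun _ => 1) (fun _ => 1) ?_ (hD ▸ isMixture_nil pos α θ) ?_)
    · refine { hs with alpha := ?_, theta := ?_, label := ?_, weight := ?_ }
      · simpa using hs.alpha
      · simpa using hs.theta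
      · simpa using hs.label
      · intro j hj
        simp
        omega
    · intro j hj
      rw [hD, List.drop_nil, isingMarginal_nil pos (by omega), mul_one]
  · simp only [Test.holds, WExpr.eval, hm] at h
    have hD : D ≠ [] := fun e => h (by simp [e])
    obtain ⟨h1, h2⟩ := hW.resolve_left hD
    exact Runs.skip (by omega) (rest s W c hs h1 h2)

theorem runs_predictProg (hB : n + 2 * D.length + 20 ≤ B) (hk : n ≤ 2 ^ k)
    (hθ : θ ∈ Set.Icc (0 : ℝ) 1) (hs : Represents pos α θ D v W s)
    (hW : D = [] ∨ IsMixture pos α θ D c ∧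
      ∀ j ≤ D.length, W j = c j * isingMarginal pos θ (D.drop j)) :
    Runs B predictProg ((D.length + 1) * (k * 37 + 220) + 70) s fun s' =>
      ∃ (W' c' : ℕ → ℝ) (yhat : ℤˣ), Represents pos α θ D v W' s' ∧ IsMixture pos α θ D c' ∧
        HoldsShares pos θ D v c' 0 s' ∧
        (∀ j ≤ D.length, W' j = c' j * isingMarginal pos θ (D.drop j)) ∧
        s'.word 0 3 = labelWord yhat ∧
        ∀ b, nextLabelWeight pos α θ D v b ≤ nextLabelWeight pos α θ D v yhat := by
  refine Runs.seq 50 ((D.length + 1) * (k * 37 + 220) + 20) (by omega)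
    ((runs_predictInit hB hs hW).mono le_rfl ?_)
  rintro s₁ ⟨W', c', h1, h2, h3, h4, h5, h6⟩
  refine Runs.seq ((D.length + 1) * (k * 37 + 220) + 4) 16 (by omega)
    ((runs_predictLoop hB hk hθ h1 h3 h4 h5 h6).mono le_rfl ?_)
  rintro s₂ ⟨g1, g2⟩
  have t1 : s₂.real 0 5 = nextLabelWeight pos α θ D v 1 := by
    rw [h2.nextLabelWeight_eq, Finset.range_eq_Ico]; exact (g2 1).2
  have t0 : s₂.real 0 4 = nextLabelWeight pos α θ D v (-1) := by
    rw [h2.nextLabelWeight_eq, Finset.range_eq_Ico]; exact (g2 (-1)).2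
  refine Runs.ite 3 (by simp) (by simp; omega) (fun h => ?_) fun h => ?_
  · simp only [Test.holds, WExpr.eval, RExpr.eval, t0, t1] at h
    refine Runs.setWord (by simp; omega) (by simp; omega) (by simp)
      ⟨W', c', -1, g1.of_sameRecord (sameRecord_setWord rfl (by simp)), h2, g2, h3, by
        simp [labelWord], fun b => ?_⟩
    rcases Int.units_eq_one_or b with rfl | rfl
    exacts [h.le, le_rfl]
  · simp only [Test.holds, WExpr.eval, RExpr.eval, t0, t1, not_lt] at h
    refine Runs.setWord (by simp; omega) (by simp; omega) (by simp)
      ⟨W', c', 1, g1.of_sameRecord (sameRecord_setWord rfl (by simp)), h2, g2, h3, by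
        simp [labelWord], fun b => ?_⟩
    rcases Int.units_eq_one_or b with rfl | rfl
    exacts [le_rfl, h]

/-- With `y` the word for the revealed label, cell `2 i + y` holds the share of that label in
component `i`. -/
theorem runs_reweightLoop {m y : ℕ} (hB : 2 * m + 20 ≤ B) (hm : s.word 0 4 = m)
    (hy : s.word 0 2 = y) (hy1 : y ≤ 1) (h5 : s.word 0 5 = 0) :
    Runs B reweightLoop ((m + 1) * 30 + 10) s fun s' =>
      (∀ i ≤ m, s'.real 1 i = (1 - s.real 0 0) * s.real 2 (2 * i + y)) ∧
      (∀ a i, ¬ (a = 0 ∧ i = 5) → s'.word a i = s.word a i) ∧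
      (∀ a i, a ≠ 1 → s'.real a i = s.real a i) := by
  refine (Runs.loop (K := 23) (k := m + 1) (I := fun k s' => ∃ i, s'.word 0 5 = i ∧ i + k = m + 1 ∧
      (∀ j < i, s'.real 1 j = (1 - s.real 0 0) * s.real 2 (2 * j + y)) ∧
      (∀ a i, ¬ (a = 0 ∧ i = 5) → s'.word a i = s.word a i) ∧
      (∀ a i, a ≠ 1 → s'.real a i = s.real a i)) ?_
    ⟨0, h5, by omega, by simp, fun _ _ _ => rfl, fun _ _ _ => rfl⟩).mono ?_ ?_
  · rintro k s₁ ⟨i, g1, g2, g3, g4, g5⟩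
    have hm₁ : s₁.word 0 4 = m := by rw [g4 _ _ (by omega), hm]
    have hy₁ : s₁.word 0 2 = y := by rw [g4 _ _ (by omega), hy]
    refine ⟨by simp [g1, hm₁]; omega, fun hc => ?_⟩
    simp only [Test.holds, WExpr.eval, g1, hm₁] at hc
    refine ⟨k - 1, by omega, Runs.seq 17 6 le_rfl (Runs.setReal ?_ ?_ (by simp) ?_)⟩
    · simp [g1]; omega
    · simp [g1, hy₁]; omega
    · refine Runs.setWord (by simp; omega) (by simp [g1]; omega) (by simp)
        ⟨i + 1, by simp [g1], by omega, fun j hj => ?_, fun a j h => ?_, fun a j h => ?_⟩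
      · simp only [WExpr.eval, RExpr.eval, State.real_setWord, State.real_setReal, g1, hy₁]
        by_cases hji : j = i
        · subst hji
          rw [if_pos (by simp), g5 _ _ (by omega), g5 _ _ (by omega), ← two_mul]
          simp
        · rw [if_neg (by omega), g3 j (by omega)]
      · simp only [WExpr.eval, State.word_setWord, State.word_setReal]
        rw [if_neg h, g4 a j h]
      · simp only [State.real_setWord, State.real_setReal]
        rw [if_neg (by omega), g5 a j h]
  · simp
  · rintro s' ⟨⟨k, i, g1, g2, g3, g4, g5⟩, h⟩
    simp only [Test.holds, WExpr.eval, g1] at h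
    rw [g4 _ _ (by omega), hm] at h
    exact ⟨fun j hj => g3 j (by omega), g4, g5⟩

/-- The memory between trials represents the pairs in `D`. As long as there are none, the
weight array need not be initialized. -/
def Ready {n : ℕ} (pos : Fin n ≃ Fin n) (α θ : ℝ) (D : List (Fin n × ℤˣ)) (s : State) : Prop :=
  ∃ (v : Fin n) (W c : ℕ → ℝ), Represents pos α θ D v W s ∧
    (D = [] ∨ IsMixture pos α θ D c ∧
      ∀ j ≤ D.length, W j = c j * isingMarginal pos θ (D.drop j))

/-- After a mistake, each share of the revealed label, discounted by `1 - α`, becomes the weight of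
its component, since the observed pair joins the constraints of every component; a component without
constraints is added for the reset. -/
theorem runs_updateProg (hB : n + 2 * D.length + 20 ≤ B) (hs : Represents pos α θ D v W s)
    (hc : IsMixture pos α θ D c) (hA : HoldsShares pos θ D v c 0 s)
    (hW : ∀ j ≤ D.length, W j = c j * isingMarginal pos θ (D.drop j)) {y yhat : ℤˣ}
    (hyhat : s.word 0 3 = labelWord yhat) (hy : s.word 0 2 = labelWord y) :
    Runs B updateProg ((D.length + 1) * 30 + 100) s
      (Ready pos α θ (if yhat ≠ y then D ++ [(v, y)] else D)) := by
  have hv := v.isLt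
  have hpv := (pos v).isLt
  have ly := labelWord_le_one y
  have lyhat := labelWord_le_one yhat
  refine Runs.ite ((D.length + 1) * 30 + 80) (by simp; omega) (by simp [hyhat, hy]; omega)
    (fun h => ?_) fun h => ?_
  · simp only [Test.holds, WExpr.eval, hyhat, hy] at h
    rw [if_neg (by simpa using labelWord_injective h)]
    exact Runs.skip (by omega) ⟨v, W, c, hs, Or.inr ⟨hc, hW⟩⟩
  simp only [Test.holds, WExpr.eval, hyhat, hy] at h
  rw [if_pos (fun e => h (by rw [e]))]
  refine Runs.seq 3 ((D.length + 1) * 30 + 77) (by omega)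
    (Runs.setWord (by simp; omega) (by simp; omega) (by simp) ?_)
  simp only [WExpr.eval]
  have h1 := hs.of_sameRecord (s' := s.setWord 0 5 0) (sameRecord_setWord rfl (by omega))
  have hA1 : HoldsShares pos θ D v c 0 (s.setWord 0 5 0) := hA
  have hy1 : (s.setWord 0 5 0).word 0 2 = labelWord y := by simpa using hy
  have h51 : (s.setWord 0 5 0).word 0 5 = 0 := by simp
  generalize s.setWord 0 5 0 = s₁ at *
  refine Runs.seq ((D.length + 1) * 30 + 10) 60 (by omega)
    ((runs_reweightLoop (by omega) h1.length hy1 ly h51).mono le_rfl ?_)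
  rintro s₂ ⟨p1, p2, p3⟩
  have m2 : s₂.word 0 4 = D.length := by rw [p2 _ _ (by omega), h1.length]
  have y2 : s₂.word 0 2 = labelWord y := by rw [p2 _ _ (by omega), hy1]
  have v2 : s₂.word 0 1 = v := by rw [p2 _ _ (by omega), h1.query]
  have v3 : s₂.word 1 v = pos v := by rw [p2 _ _ (by omega), h1.position]
  have n2 : s₂.word 0 0 = n := by rw [p2 _ _ (by omega), h1.size]
  refine Runs.seq 13 47 le_rfl (Runs.setReal (by simp [m2]; omega) (by simp [y2]; omega)
    (by simp) ?_)
  refine Runs.seq 6 41 le_rfl (Runs.setWord (by simp [m2]; omega) (by simp [v2, v3]; omega)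
    (by simp) ?_)
  have tot : s₂.real 0 (4 + labelWord y) = nextLabelWeight pos α θ D v y := by
    rw [p3 _ _ (by omega), hc.nextLabelWeight_eq, Finset.range_eq_Ico]
    exact (hA1 y).2
  -- The last step, once the observed pair has been recorded.
  have fin : ∀ s₃ : State,
      s₃.word = ((s₂.setReal 1 (D.length + 1) (α * nextLabelWeight pos α θ D v y)).setWord 2
        D.length (pos v)).word →
      (∀ a i, s₃.real a i = if a = 3 ∧ i = D.length then ((y : ℤ) : ℝ)
        else if a = 1 ∧ i = D.length + 1 then α * nextLabelWeight pos α θ D v y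
        else s₂.real a i) →
      Runs B (.setWord 0 (.lit 4) (.add (wordVar 4) (.lit 1))) 10 s₃
        (Ready pos α θ (D ++ [(v, y)])) := by
    intro s₃ e1 e2
    refine Runs.setWord (by simp; omega) (by simp [e1, m2]; omega) (by simp) ⟨v,
      fun j => if j = D.length + 1 then α * nextLabelWeight pos α θ D v y
        else (1 - α) * (c j * isingMarginal pos θ ((v, y) :: D.drop j)), _,
      ⟨?_, ?_, ?_, ?_, ?_, ?_, ?_, ?_, ?_⟩, Or.inr ⟨hc.concat v y, ?_⟩⟩
    · simp [e1, n2]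
    · simp [e1, v2]
    · simp [e1, m2]
    · intro w
      simp [e1]
      rw [p2 _ _ (by omega), h1.position]
    · intro j hj
      rw [List.length_append, List.length_singleton] at hj
      rcases (Nat.lt_succ_iff.1 hj).eq_or_lt with rfl | hj'
      · simp [e1]
      · simp [e1, hj'.ne, List.getElem_append_left hj']
        rw [p2 _ _ (by omega), h1.place j hj']
    · simp [e2]
      rw [p3 _ _ (by omega), h1.alpha]
    · simp [e2]
      rw [p3 _ _ (by omega), h1.theta]
    · intro j hj
      rw [List.length_append, List.length_singleton] at hj
      rcases (Nat.lt_succ_iff.1 hj).eq_or_lt with rfl | hj'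
      · simp [e2]
      · simp [e2, hj'.ne, List.getElem_append_left hj']
        rw [p3 _ _ (by omega), h1.label j hj']
    · intro j hj
      rw [List.length_append, List.length_singleton] at hj
      simp only [State.real_setWord, e2]
      rw [if_neg (by omega)]
      by_cases hj' : j = D.length + 1
      · simp [hj']
      · rw [if_neg (by omega), if_neg hj', p1 j (by omega), h1.alpha,
          (hA1 y).1 j (by omega) (by omega)]
    · intro j hj
      rw [List.length_append, List.length_singleton] at hj
      beta_reduce
      by_cases hj' : j = D.length + 1
      · rw [if_pos hj', if_neg (by omega), List.drop_eq_nil_of_le (by simp; omega),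
          isingMarginal_nil pos (by omega), mul_one]
      · rw [if_neg hj', if_pos (by omega), List.drop_append_of_le_length (by omega),
          isingMarginal_concat, mul_assoc]
  have α2 : s₂.real 0 0 = α := by rw [p3 _ _ (by omega), h1.alpha]
  refine Runs.seq 20 10 (by omega) (Runs.ite 10 (by simp) (by simp [y2]; omega)
    (fun h => ?_) fun h => ?_)
  · simp [y2] at h
    obtain rfl : y = 1 := labelWord_injective h
    refine Runs.setReal (by simp [m2]; omega) (by simp) (by simp) (fin _ ?_ ?_)
    · simp [m2, v2, v3, y2, tot, α2]
    · intro a i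
      simp [m2, y2, tot, α2]
  · simp [y2] at h
    obtain rfl : y = -1 := by
      rcases Int.units_eq_one_or y with rfl | rfl
      · exact absurd rfl h
      · rfl
    refine Runs.setReal (by simp [m2]; omega) (by simp) (by simp) (fin _ ?_ ?_)
    · simp [m2, v2, v3, y2, tot, α2]
    · intro a i
      simp [m2, y2, tot, α2]

end

end RealRAM

theorem mistakeHistory_succ {n : ℕ} (i : ℕ → Fin n) (y yhat : ℕ → ℤˣ) (t : ℕ) :
    mistakeHistory i y yhat (t + 1) =
      if yhat t ≠ y t then mistakeHistory i y yhat t ++ [(i t, y t)]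
      else mistakeHistory i y yhat t := by
  by_cases h : yhat t = y t <;>
    simp [mistakeHistory, List.range_succ, List.filter_append, h]

namespace RealRAM

/-! ### Runs of the online algorithm -/

/-- The online algorithm. -/
def qbayAlgorithm : OnlineAlgorithm where
  predict := predictProg
  update := updateProg

theorem ready_initialState {n : ℕ} (hn : 0 < n) (pos : Fin n ≃ Fin n) (α θ : ℝ) :
    Ready pos α θ [] (initialState pos α θ) :=
  ⟨⟨0, hn⟩, fun _ => 0, fun _ => 0,
    ⟨by simp [initialState], by simp [initialState], by simp [initialState],
      by simp [initialState], by simp, by simp [initialState], by simp [initialState], by simp,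
      by simp [initialState]⟩, Or.inl rfl⟩

/-- One trial turns the record of the mispredicted pairs into that of the next trial, with a
prediction that maximizes the joint weight. -/
theorem exists_trial {n : ℕ} {pos : Fin n ≃ Fin n} {α θ : ℝ} {D : List (Fin n × ℤˣ)}
    {s : State} {B k : ℕ} (hB : n + 2 * D.length + 20 ≤ B) (hk : n ≤ 2 ^ k)
    (hθ : θ ∈ Set.Icc (0 : ℝ) 1) (hs : Ready pos α θ D s) (v : Fin n) (y : ℤˣ) :
    ∃ (yhat : ℤˣ) (time : ℕ) (s' : State),
      qbayAlgorithm.Trial B s v y yhat time s' ∧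
      time ≤ (D.length + 1) * (k * 37 + 420) ∧
      (∀ b, nextLabelWeight pos α θ D v b ≤ nextLabelWeight pos α θ D v yhat) ∧
      Ready pos α θ (if yhat ≠ y then D ++ [(v, y)] else D) s' := by
  obtain ⟨v₀, W, c, hs, hW⟩ := hs
  have hs' : Represents pos α θ D v W (s.setWord 0 1 v) :=
    { hs with
      size := by simpa using hs.size
      query := by simp
      length := by simpa using hs.length
      position := by simpa using hs.position
      place := by simpa using hs.place }
  obtain ⟨k₁, r, h1, h2, W', c', yhat, h3, h4, h5, h6, h7, h8⟩ :=
    runs_predictProg hB hk hθ hs' hW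
  have e : SameRecord r (r.setWord 0 2 (labelWord y)) := sameRecord_setWord rfl (by omega)
  obtain ⟨k₂, s', g1, g2, g3⟩ := runs_updateProg (y := y) (yhat := yhat) hB (h3.of_sameRecord e)
    h4 h5 h6 (by simpa using h7) (by simp)
  refine ⟨yhat, k₁ + k₂, s', ⟨k₁, k₂, r, h1, h7, g1, rfl⟩, ?_, h8, g3⟩
  have h2' : k₁ + k₂ ≤ ((D.length + 1) * (k * 37 + 220) + 70) + ((D.length + 1) * 30 + 100) :=
    add_le_add h2 g2
  nlinarith

/-- The number of iterations of the exponentiation is logarithmic, also for the smallest `n`. -/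
theorem trial_time_le {n t m k : ℕ} (hn : 2 ≤ n) (hm : m ≤ t)
    (hk : k ≤ (m + 1) * ((Nat.log 2 n + 1) * 37 + 420)) :
    (k : ℝ) ≤ ((1000 : ℕ) : ℝ) * (((t : ℝ) + 1) * Real.log n) := by
  have hn0 : (0 : ℝ) < n := by positivity
  have hl2 := Real.log_two_gt_d9
  have h1 : (Nat.log 2 n : ℝ) * Real.log 2 ≤ Real.log n := by
    rw [← Real.log_pow]
    exact Real.log_le_log (by positivity) (by exact_mod_cast Nat.pow_log_le_self 2 (by omega))
  have h2 : Real.log 2 ≤ Real.log n := Real.log_le_log (by norm_num) (by exact_mod_cast hn)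
  have h3 : (Nat.log 2 n : ℝ) ≤ 2 * Real.log n := by
    have : (0 : ℝ) ≤ Nat.log 2 n := by positivity
    nlinarith
  -- The constant `457` is absorbed because `log n ≥ log 2 > 0.69`.
  have h4 : ((Nat.log 2 n + 1 : ℝ)) * 37 + 420 ≤ 1000 * Real.log n := by linarith
  have h5 : (k : ℝ) ≤ ((m : ℝ) + 1) * (((Nat.log 2 n : ℝ) + 1) * 37 + 420) := by exact_mod_cast hk
  have h6 : (m : ℝ) ≤ t := by exact_mod_cast hm
  calc (k : ℝ) ≤ ((m : ℝ) + 1) * (((Nat.log 2 n : ℝ) + 1) * 37 + 420) := h5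
    _ ≤ ((t : ℝ) + 1) * (1000 * Real.log n) := by gcongr
    _ = _ := by push_cast; ring

end RealRAM

theorem mainTheorem7 :
    ∃ (A : RealRAM.OnlineAlgorithm) (C : ℕ),
      ∀ (n : ℕ), 2 ≤ n →
      ∀ (pos : Fin n ≃ Fin n) (α θ : ℝ), α ∈ Set.Icc (0 : ℝ) 1 → θ ∈ Set.Icc (0 : ℝ) 1 →
      ∀ (i : ℕ → Fin n) (y : ℕ → ℤˣ),
        ∃ (yhat : ℕ → ℤˣ) (st : ℕ → RealRAM.State) (time : ℕ → ℕ),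
          st 0 = RealRAM.initialState pos α θ ∧
          (∀ t : ℕ,
            A.Trial (C * (t + 1) * n) (st t) (i t) (y t) (yhat t) (time t) (st (t + 1))) ∧
          (∀ t : ℕ, (time t : ℝ) ≤ (C : ℝ) * (((t : ℝ) + 1) * Real.log (n : ℝ))) ∧
          IsQBay pos α θ i y yhat := by
  refine ⟨RealRAM.qbayAlgorithm, 1000, fun n hn pos α θ hα hθ i y => ?_⟩
  have hNe : Nonempty RealRAM.State := ⟨RealRAM.initialState pos α θ⟩
  have step : ∀ (t : ℕ) (D : List (Fin n × ℤˣ)) (s : RealRAM.State),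
      D.length ≤ t ∧ RealRAM.Ready pos α θ D s →
      ∃ (yhat : ℤˣ) (time : ℕ) (s' : RealRAM.State),
        RealRAM.qbayAlgorithm.Trial (1000 * (t + 1) * n) s (i t) (y t) yhat time s' ∧
        time ≤ (D.length + 1) * ((Nat.log 2 n + 1) * 37 + 420) ∧
        (∀ b, nextLabelWeight pos α θ D (i t) b ≤ nextLabelWeight pos α θ D (i t) yhat) ∧
        RealRAM.Ready pos α θ (if yhat ≠ y t then D ++ [(i t, y t)] else D) s' :=
    fun t D s h => RealRAM.exists_trial (by nlinarith [h.1])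
      (Nat.lt_pow_succ_log_self (by norm_num) n).le hθ h.2 (i t) (y t)
  choose! f time g hTrial hTime hMax hReady using step
  let x : ℕ → List (Fin n × ℤˣ) × RealRAM.State := fun t => Nat.rec
    ([], RealRAM.initialState pos α θ)
    (fun t x => (if f t x.1 x.2 ≠ y t then x.1 ++ [(i t, y t)] else x.1, g t x.1 x.2)) t
  have hx : ∀ t, (x t).1.length ≤ t ∧ RealRAM.Ready pos α θ (x t).1 (x t).2 := by
    intro t
    induction t with
    | zero => exact ⟨le_rfl, RealRAM.ready_initialState (by omega) pos α θ⟩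
    | succ t ih =>
      refine ⟨?_, hReady t _ _ ih⟩
      change (if f t (x t).1 (x t).2 ≠ y t then (x t).1 ++ [(i t, y t)] else (x t).1).length ≤ t + 1
      split_ifs
      · simpa using ih.1
      · exact ih.1.trans (Nat.le_succ t)
  have hD : ∀ t, mistakeHistory i y (fun t => f t (x t).1 (x t).2) t = (x t).1 := by
    intro t
    induction t with
    | zero => rfl
    | succ t ih => rw [mistakeHistory_succ, ih]
  refine ⟨fun t => f t (x t).1 (x t).2, fun t => (x t).2, fun t => time t (x t).1 (x t).2, rfl,
    fun t => hTrial t _ _ (hx t), fun t => RealRAM.trial_time_le hn (hx t).1 (hTime t _ _ (hx t)),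
    fun t b => ?_⟩
  rw [predictiveProb, predictiveProb, switchResetProb_eq_nextLabelWeight,
    switchResetProb_eq_nextLabelWeight, hD t]
  exact div_le_div_of_nonneg_right (hMax t _ _ (hx t) b) (switchResetProb_nonneg pos hα hθ _)
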